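/- Let $d\in\{2,3\}$, $\Omega=[0,2\pi]^d$, and for $k\in\mathbb Z^d$ let $\hat f(k)=(2\pi)^{-d}\int_\Omega f(x)e^{-ik\cdot x}\,dx$. Let $H_{\mathbb C}$ be the space of fields $u\in L^2(\Omega;\mathbb C^d)$ with $\hat u(0)=0$ and $k\cdot\hat u(k)=0$ for all $k\in\mathbb Z^d$ (periodic, mean zero, divergence free), with the $L^2$ norm, and let $H$ be the set of its real-valued elements. For $u,v\in H_{\mathbb C}$ let $B(u,v)=\mathbb P\,\nabla\cdot(u\otimes v)$, where $\mathbb P$ is the Leray–Helmholtz projection; this is the periodic distribution with Fourier coefficients $$\widehat{B(u,v)}(k)=\Pi_k\sum_{m=1}^d i k_m\,\widehat{u_m v}(k),\qquad \Pi_k w=w-\frac{k\cdot w}{|k|^2}\,k\ \ (k\neq0),\quad \Pi_0w=w .$$ It is complex bilinear. Fix $r>\frac{d+1}{2}$ and, for $\beta>0$, define the Gevrey norm by $$\|u\|_\beta=\Big((2\pi)^d\sum_{k\in\mathbb Z^d}|k|^{2r}e^{2\beta|k|}|\hat u(k)|^2\Big)^{1/2}\in[0,\infty].$$ Let $T>0$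 and let $u:[0,T]\to H$ be a solution of the Euler equation $\frac{du}{dt}+B(u,u)=0$ on $[0,T]$, in the sense that for every $k$ the function $t\mapsto\hat u(t)(k)$ is differentiable on $[0,T]$ (one-sidedly at the end points) with derivative $-\widehat{B(u(t),u(t))}(k)$. Suppose that there is a continuous function $\beta:[0,T]\to(0,\infty)$ with $$\sup_{t\in[0,T]}\|u(t)\|_{\beta(t)}<\infty .$$ Then there are an open set $U\subseteq\mathbb C$ containing the interval $(0,T)$, a number $\beta_1>0$ and a map $v:U\to H_{\mathbb C}$ such that 1. $v(t)=u(t)$ for all $t\in(0,T)$; 2. $v$ is holomorphic on $U$ with values in $H_{\mathbb C}$ and also with values in the Gevrey class $\{w\in H_{\mathbb C}:\|w\|_{\beta_1}<\infty\}$, i.e. for every $\zeta\in U$ both $\|v(\zeta)\|_{\beta_1}$ and $\|v'(\zeta)\|_{\beta_1}$ are finite and $\big\|\frac{v(z)-v(\zeta)}{z-\zeta}-v'(\zeta)\big\|_{\beta_1}\to0$ as $z\to\zeta$; 3. $\frac{dv}{d\zeta}(\zeta)+B(v(\zeta),v(\zeta))=0$ for all $\zeta\in U$. -/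

import Mathlib

open MeasureTheory Set Filter Topology
open scoped ENNReal

namespace PeriodicEuler

noncomputable section

/-- The periodicity cell `Ω = [0, 2π]^d`. -/
def cell (d : ℕ) : Set (Fin d → ℝ) := Set.Icc (fun _ => 0) (fun _ => 2 * Real.pi)

/-- Square integrable fields `Ω → ℂ^d`. Real fields are those that are a.e. real, see `IsReal`. -/
abbrev L2Field (d : ℕ) : Type :=
  Lp (EuclideanSpace ℂ (Fin d)) 2 ((volume : Measure (Fin d → ℝ)).restrict (cell d))

/-- The function `x ↦ exp (-i k · x)`. -/
def wave {d : ℕ} (k : Fin d → ℤ) (x : Fin d → ℝ) : ℂ :=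
  Complex.exp (-(Complex.I * ∑ i, (k i : ℂ) * (x i : ℂ)))

/-- The Fourier coefficient `(2π)^{-d} ∫_Ω f(x) exp (-i k · x) dx`. -/
def coeff {d : ℕ} {E : Type*} [NormedAddCommGroup E] [NormedSpace ℂ E]
    (f : (Fin d → ℝ) → E) (k : Fin d → ℤ) : E :=
  (((2 * Real.pi : ℝ) : ℂ) ^ d)⁻¹ • ∫ x in cell d, wave k x • f x

/-- The Euclidean length `|k|` of a wave vector. -/
def len {d : ℕ} (k : Fin d → ℤ) : ℝ := Real.sqrt (∑ i, (k i : ℝ) ^ 2)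

theorem integrable_wave_smul {d : ℕ} (u : L2Field d) (k : Fin d → ℤ) :
    Integrable (fun x => wave k x • u x) (volume.restrict (cell d)) := by
  have : IsFiniteMeasure ((volume : Measure (Fin d → ℝ)).restrict (cell d)) :=
    ⟨by
      rw [Measure.restrict_apply_univ]
      exact isCompact_Icc.measure_lt_top⟩
  have hu : Integrable u (volume.restrict (cell d)) := (Lp.memLp u).integrable (by norm_num)
  refine Integrable.bdd_smul (φ := wave k) hu 1 ?_ ?_
  · have : Continuous (wave k) := by unfold wave; fun_prop
    exact this.aestronglyMeasurable
  · refine Eventually.of_forall fun x => ?_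
    have h : -(Complex.I * ∑ i, (k i : ℂ) * (x i : ℂ))
        = ((-∑ i, (k i : ℝ) * x i : ℝ) : ℂ) * Complex.I := by
      push_cast; ring
    rw [wave, h, Complex.norm_exp_ofReal_mul_I]

theorem coeff_add {d : ℕ} (u v : L2Field d) (k : Fin d → ℤ) :
    coeff (u + v : L2Field d) k = coeff u k + coeff v k := by
  unfold coeff
  rw [← smul_add, ← integral_add (integrable_wave_smul u k) (integrable_wave_smul v k)]
  congr 1
  refine integral_congr_ae ?_
  filter_upwards [Lp.coeFn_add u v] with x hx
  rw [hx, Pi.add_apply, smul_add]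

theorem coeff_smul {d : ℕ} (c : ℂ) (u : L2Field d) (k : Fin d → ℤ) :
    coeff (c • u : L2Field d) k = c • coeff u k := by
  unfold coeff
  rw [smul_comm c, ← integral_smul c (fun x => wave k x • u x)]
  congr 1
  refine integral_congr_ae ?_
  filter_upwards [Lp.coeFn_smul c u] with x hx
  rw [hx, Pi.smul_apply, smul_comm]

theorem coeff_zero {d : ℕ} (k : Fin d → ℤ) : coeff (0 : L2Field d) k = 0 := by
  simpa using coeff_smul (0 : ℂ) (0 : L2Field d) k

/-- The complexified phase space `H_ℂ` with the `L²` norm: square integrable fields of zero mean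
that are divergence free in the sense of periodic distributions, i.e. `k · û(k) = 0` for all `k`. -/
def PhaseSpace (d : ℕ) : Submodule ℂ (L2Field d) where
  carrier := {u | coeff u 0 = 0 ∧ ∀ k : Fin d → ℤ, ∑ i, (k i : ℂ) * coeff u k i = 0}
  zero_mem' := by
    refine ⟨coeff_zero 0, fun k => ?_⟩
    rw [coeff_zero]
    simp
  add_mem' := by
    rintro u v ⟨hu0, hu⟩ ⟨hv0, hv⟩
    refine ⟨by rw [coeff_add, hu0, hv0, add_zero], fun k => ?_⟩
    rw [coeff_add]
    simp only [PiLp.add_apply, mul_add, Finset.sum_add_distrib, hu k, hv k, add_zero]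
  smul_mem' := by
    rintro c u ⟨hu0, hu⟩
    refine ⟨by rw [coeff_smul, hu0, smul_zero], fun k => ?_⟩
    rw [coeff_smul]
    simp only [PiLp.smul_apply, smul_eq_mul, mul_left_comm _ c, ← Finset.mul_sum, hu k, mul_zero]

/-- The Fourier coefficients of an element of the phase space. -/
def hat {d : ℕ} (u : PhaseSpace d) (k : Fin d → ℤ) : EuclideanSpace ℂ (Fin d) :=
  coeff (u : L2Field d) k

/-- `u` is real valued, i.e. it belongs to the real phase space `H`. -/
def IsReal {d : ℕ} (u : PhaseSpace d) : Prop :=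
  ∀ᵐ x ∂(volume.restrict (cell d)), ∀ i, ((u : L2Field d) x i).im = 0

/-- The Gevrey norm `‖A^{r/2} exp (β A^{1/2}) u‖`, with value `∞` if `u` is not in the class:
`A` is the Fourier multiplier `|k|²`, and `‖f‖² = (2π)^d ∑_k |f̂(k)|²`. -/
def gevreyNorm {d : ℕ} (r β : ℝ) (u : PhaseSpace d) : ℝ≥0∞ :=
  (ENNReal.ofReal ((2 * Real.pi) ^ d) *
    ∑' k : Fin d → ℤ,
      ENNReal.ofReal ((len k ^ r * Real.exp (β * len k) * ‖hat u k‖) ^ 2)) ^ (1 / 2 : ℝ)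

/-- The Fourier symbol of the Leray-Helmholtz projection, `w ↦ w - (k · w) k / |k|²`
(the identity for `k = 0`). -/
def leray {d : ℕ} (k : Fin d → ℤ) (w : EuclideanSpace ℂ (Fin d)) : EuclideanSpace ℂ (Fin d) :=
  w - ((∑ i, (k i : ℂ) * w i) / (∑ i, (k i : ℂ) ^ 2)) • WithLp.toLp 2 (fun i => (k i : ℂ))

/-- The `k`-th Fourier coefficient of the distribution `B(u, v) = ℙ ∇ · (u ⊗ v)`, whose `j`-th
component before projection is `∑_m ∂_m (u_m v_j)`. The products are products of complex numbers
(no conjugation), so this is bilinear over `ℂ` and for complex fields it is the complexified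
nonlinearity `B(u₁,v₁) - B(u₂,v₂) + i (B(u₁,v₂) + B(u₂,v₁))`. -/
def nonlin {d : ℕ} (u v : PhaseSpace d) (k : Fin d → ℤ) : EuclideanSpace ℂ (Fin d) :=
  leray k (∑ m, (Complex.I * (k m : ℂ)) •
    coeff (fun x => ((u : L2Field d) x m) • ((v : L2Field d) x)) k)

/-- `u` is a real solution on `[0, T]` of `du/dt + B(u, u) = 0`. The equation is read in the weak
sense, as an identity of distributions in space tested against each Fourier mode (with one-sided
time derivatives at `0` and `T`). -/
structure IsEulerSolution {d : ℕ} (T : ℝ) (u : ℝ → PhaseSpace d) : Prop where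
  isReal : ∀ t ∈ Icc 0 T, IsReal (u t)
  equation : ∀ t ∈ Icc 0 T, ∀ k : Fin d → ℤ,
    HasDerivWithinAt (fun s => hat (u s) k) (-nonlin (u t) (u t) k) (Icc 0 T) t

/-- `v` takes values in the Gevrey class near `ζ` and has complex derivative `v'` at `ζ` with
respect to the Gevrey norm. -/
def HasGevreyDerivAt {d : ℕ} (r β : ℝ) (v : ℂ → PhaseSpace d) (v' : PhaseSpace d) (ζ : ℂ) : Prop :=
  (∀ᶠ z in 𝓝 ζ, gevreyNorm r β (v z) < ∞) ∧ gevreyNorm r β v' < ∞ ∧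
    Tendsto (fun z => gevreyNorm r β ((z - ζ)⁻¹ • (v z - v ζ) - v')) (𝓝[≠] ζ) (𝓝 0)

end

end PeriodicEuler

namespace PeriodicEuler

noncomputable section

/-! The proof is an abstract Cauchy–Kovalevskaya argument on the Fourier side. A continuous positive
`β` has a positive minimum on the compact time interval, so the modes of `u t` decay exponentially,
uniformly in time (`exists_uniform_decay`). In the exponentially weighted Wiener algebra the
nonlinearity loses one derivative, which costs a factor `2 / (β - β')` when the weight drops from
`β` to `β'` (`wienerNorm_conv_le`). Feeding this into the recursion for the formal Taylor
coefficients in time, with Catalan numbers as majorant, gives a geometric bound `M * R ^ n`, uniform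
in the centre (`wienerNorm_taylor_le`).

The formal coefficients at time `t` are the true ones: differentiating the `n`-th in `t` gives `n +
1` times the next (`hasDerivAt_taylor`). Hence the derivative of the Taylor sum with respect to its
centre telescopes to zero, and the sum does not depend on the centre (`tsum_taylor_eq`). Expanding
at `ζ.re` therefore defines a holomorphic function on the strip `|ζ.im| < 1 / (2 * R)`. It equals
the solution at real times because only the zeroth term survives there, so no uniqueness theorem is
involved. The equation extends from the real segment to the strip by the identity theorem
(`deriv_complexMode_add_conv`).

The values are taken in an `ℓ¹` space of weighted amplitudes. A bounded linear map `synth` carries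
them to the phase space and to a Gevrey class, so holomorphy is proved only once. The mode
projection is built into `synth` to make it land in the solenoidal fields; on the flow it acts as
the identity. -/

instance isFiniteMeasure_restrict_cell (d : ℕ) :
    IsFiniteMeasure ((volume : Measure (Fin d → ℝ)).restrict (cell d)) :=
  ⟨by
    rw [Measure.restrict_apply_univ]
    exact isCompact_Icc.measure_lt_top⟩

theorem continuous_wave {d : ℕ} (k : Fin d → ℤ) : Continuous (wave k) := by
  unfold wave; fun_prop

theorem norm_wave {d : ℕ} (k : Fin d → ℤ) (x : Fin d → ℝ) : ‖wave k x‖ = 1 := by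
  have h : -(Complex.I * ∑ i, (k i : ℂ) * (x i : ℂ))
      = ((-∑ i, (k i : ℝ) * x i : ℝ) : ℂ) * Complex.I := by
    push_cast; ring
  rw [wave, h, Complex.norm_exp_ofReal_mul_I]

theorem wave_add {d : ℕ} (k l : Fin d → ℤ) (x : Fin d → ℝ) :
    wave (k + l) x = wave k x * wave l x := by
  simp only [wave, ← Complex.exp_add, Pi.add_apply]
  congr 1
  push_cast
  simp only [add_mul, Finset.sum_add_distrib]
  ring

/-! ### Fourier analysis on the cell, transported from the unit torus. -/

section Torus

/-- The normalised Haar measure on the circle, as in the theory of Fourier series on the torus. -/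
local instance : MeasureSpace UnitAddCircle := ⟨AddCircle.haarAddCircle⟩

local instance : Measure.IsAddHaarMeasure (volume : Measure UnitAddCircle) :=
  inferInstanceAs (Measure.IsAddHaarMeasure AddCircle.haarAddCircle)

local instance : IsProbabilityMeasure (volume : Measure UnitAddCircle) :=
  inferInstanceAs (IsProbabilityMeasure AddCircle.haarAddCircle)

/-- The section `y ↦ 2π y` of the torus in the periodicity cell. -/
def torusSection (d : ℕ) (y : UnitAddTorus (Fin d)) : Fin d → ℝ :=
  (2 * Real.pi) • (UnitAddTorus.measurableEquivPiIoc (0 : Fin d → ℝ) y).1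

/-- Scaling `(0, 1]^d` by `2π` gives `(0, 2π]^d`, which differs from the closed cell by a null set;
the Jacobian is the normalisation in `coeff`. -/
theorem measurePreserving_torusSection (d : ℕ) :
    MeasurePreserving (torusSection d) volume
      ((ENNReal.ofReal ((2 * Real.pi) ^ d))⁻¹ • volume.restrict (cell d)) := by
  have hpi : (0 : ℝ) < 2 * Real.pi := by positivity
  have h1 := UnitAddTorus.measurePreserving_equivPiIoc (0 : Fin d → ℝ)
  set S : Set (Fin d → ℝ) := {x | ∀ i, x i ∈ Ioc ((0 : Fin d → ℝ) i) ((0 : Fin d → ℝ) i + 1)}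
    with hS
  have hSm : MeasurableSet S := MeasurableSet.univ_pi' (fun i => measurableSet_Ioc)
  have h2 : MeasurePreserving (Subtype.val : S → (Fin d → ℝ)) (Measure.comap Subtype.val volume)
      (volume.restrict S) := ⟨measurable_subtype_coe, map_comap_subtype_coe hSm volume⟩
  have h3 : MeasurePreserving (fun x : Fin d → ℝ => (2 * Real.pi) • x) (volume.restrict S)
      ((ENNReal.ofReal ((2 * Real.pi) ^ d))⁻¹ • volume.restrict (cell d)) := by
    refine ⟨measurable_const_smul _, ?_⟩
    have hS' : S = (fun x : Fin d → ℝ => (2 * Real.pi) • x) ⁻¹'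
        (univ.pi fun _ => Ioc (0 : ℝ) (2 * Real.pi)) := by
      ext x
      simp [hS, hpi]
    rw [hS', ← Measure.restrict_map (measurable_const_smul _)
      (MeasurableSet.univ_pi fun _ => measurableSet_Ioc),
      Measure.map_addHaar_smul _ hpi.ne', Measure.restrict_smul]
    congr 1
    · rw [Module.finrank_fin_fun, abs_of_pos (by positivity),
        ENNReal.ofReal_inv_of_pos (by positivity)]
    · exact Measure.restrict_congr_set Measure.univ_pi_Ioc_ae_eq_Icc
  exact h3.comp (h2.comp h1)

theorem wave_torusSection {d : ℕ} (k : Fin d → ℤ) (y : UnitAddTorus (Fin d)) :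
    wave k (torusSection d y) = UnitAddTorus.mFourier (-k) y := by
  have h : y = fun i => (((UnitAddTorus.measurableEquivPiIoc (0 : Fin d → ℝ) y).1 i : ℝ) :
      UnitAddCircle) :=
    ((UnitAddTorus.measurableEquivPiIoc (0 : Fin d → ℝ)).symm_apply_apply y).symm
  set x := (UnitAddTorus.measurableEquivPiIoc (0 : Fin d → ℝ) y).1 with hx
  conv_rhs => rw [h]
  simp only [UnitAddTorus.mFourier, ContinuousMap.coe_mk, fourier_coe_apply, wave, torusSection,
    ← hx, ← Complex.exp_sum]
  congr 1
  rw [Finset.mul_sum, ← Finset.sum_neg_distrib]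
  refine Finset.sum_congr rfl fun i _ => ?_
  simp
  ring

theorem mFourierCoeff_comp_torusSection {d : ℕ} {E : Type*} [NormedAddCommGroup E]
    [NormedSpace ℂ E] {f : (Fin d → ℝ) → E}
    (hf : AEStronglyMeasurable f (volume.restrict (cell d))) (k : Fin d → ℤ) :
    UnitAddTorus.mFourierCoeff (f ∘ torusSection d) k = coeff f k := by
  have hm := measurePreserving_torusSection d
  have : UnitAddTorus.mFourierCoeff (f ∘ torusSection d) k
      = ∫ y, (fun x => wave k x • f x) (torusSection d y) := by
    simp only [UnitAddTorus.mFourierCoeff, wave_torusSection, Function.comp]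
  have hw : AEStronglyMeasurable (fun x => wave k x • f x)
      (Measure.map (torusSection d) volume) := by
    rw [hm.map_eq]
    exact ((continuous_wave k).aestronglyMeasurable.smul hf).smul_measure _
  rw [this]
  refine (integral_map hm.measurable.aemeasurable hw).symm.trans ?_
  rw [hm.map_eq, integral_smul_measure, coeff, ENNReal.toReal_inv,
    ENNReal.toReal_ofReal (by positivity), ← Complex.coe_smul]
  norm_cast

theorem integral_mFourier {d : ℕ} (k : Fin d → ℤ) :
    ∫ y, UnitAddTorus.mFourier k y = if k = 0 then 1 else 0 := by
  have h := orthonormal_iff_ite.mp (UnitAddTorus.orthonormal_mFourier (d := Fin d)) 0 k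
  simpa [ContinuousMap.inner_toLp, UnitAddTorus.mFourier_zero, eq_comm] using h

theorem coeff_wave {d : ℕ} {E : Type*} [NormedAddCommGroup E] [NormedSpace ℂ E] [CompleteSpace E]
    (j k : Fin d → ℤ) (w : E) :
    coeff (fun x => wave (-j) x • w) k = if j = k then w else 0 := by
  rw [← mFourierCoeff_comp_torusSection]
  · have : ∀ y, UnitAddTorus.mFourier (-k) y • ((fun x => wave (-j) x • w) ∘ torusSection d) y
        = UnitAddTorus.mFourier (j - k) y • w := by
      intro y
      simp only [Function.comp, wave_torusSection, neg_neg, smul_smul,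
        ← UnitAddTorus.mFourier_add]
      congr 3
      abel
    simp only [UnitAddTorus.mFourierCoeff, this]
    rw [integral_smul_const, integral_mFourier]
    simp [sub_eq_zero]
  · exact ((continuous_wave _).smul continuous_const).aestronglyMeasurable

/-- A square integrable function on the cell with vanishing Fourier coefficients is zero. -/
theorem ae_eq_zero_of_coeff_eq_zero {d : ℕ} {f : (Fin d → ℝ) → ℂ} (hf : StronglyMeasurable f)
    (hf2 : MemLp f 2 (volume.restrict (cell d))) (h : ∀ k, coeff f k = 0) :
    f =ᵐ[volume.restrict (cell d)] 0 := by
  have hm := measurePreserving_torusSection d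
  have hc0 : (ENNReal.ofReal ((2 * Real.pi) ^ d))⁻¹ ≠ ∞ :=
    ENNReal.inv_ne_top.2 (ENNReal.ofReal_pos.2 (by positivity)).ne'
  have hF : MemLp (f ∘ torusSection d) 2 volume :=
    (hf2.smul_measure hc0).comp_measurePreserving hm
  have h0 : hF.toLp = 0 := by
    apply (UnitAddTorus.mFourierBasis (d := Fin d)).repr.injective
    rw [map_zero]
    ext k
    rw [UnitAddTorus.mFourierBasis_repr]
    have : UnitAddTorus.mFourierCoeff (hF.toLp) k
        = UnitAddTorus.mFourierCoeff (f ∘ torusSection d) k := by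
      refine integral_congr_ae ?_
      filter_upwards [hF.coeFn_toLp] with y hy
      rw [hy]
    rw [this, mFourierCoeff_comp_torusSection hf.aestronglyMeasurable, h k]
    rfl
  have h1 : ∀ᵐ y, f (torusSection d y) = 0 := by
    have := hF.coeFn_toLp
    rw [h0] at this
    filter_upwards [this, Lp.coeFn_zero ℂ 2 (volume : Measure (UnitAddTorus (Fin d)))]
      with y hy hy0
    rw [hy0] at hy
    exact hy.symm
  -- Strong measurability of `f` makes its zero set measurable, so the a.e. statement descends to
  -- the image measure.
  have h2 := (ae_map_iff hm.measurable.aemeasurable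
    (measurableSet_eq_fun hf.measurable measurable_const)).2 h1
  rw [hm.map_eq] at h2
  rwa [Measure.ae_ennreal_smul_measure_eq (ENNReal.inv_ne_zero.2 ENNReal.ofReal_ne_top)] at h2

end Torus

/-- Complex amplitudes of Fourier modes. -/
abbrev Amp (d : ℕ) : Type := EuclideanSpace ℂ (Fin d)

/-! ### Absolutely convergent Fourier series, and products as convolutions. -/

section Coefficients

variable {d : ℕ}

theorem tsum_smul_amp {ι : Type*} {f : ι → ℂ} (hf : Summable f) (w : Amp d) :
    (∑' j, f j) • w = ∑' j, f j • w :=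
  (hf.tsum_smul_const w).symm

theorem coeff_congr_ae {E : Type*} [NormedAddCommGroup E] [NormedSpace ℂ E]
    {f g : (Fin d → ℝ) → E} (h : f =ᵐ[volume.restrict (cell d)] g) (k : Fin d → ℤ) :
    coeff f k = coeff g k := by
  unfold coeff
  congr 1
  refine integral_congr_ae ?_
  filter_upwards [h] with x hx
  rw [hx]

theorem coeff_comp_clm {E F : Type*} [NormedAddCommGroup E] [NormedSpace ℂ E] [CompleteSpace E]
    [NormedAddCommGroup F] [NormedSpace ℂ F] [CompleteSpace F] (L : E →L[ℂ] F)
    {f : (Fin d → ℝ) → E} (hf : Integrable f (volume.restrict (cell d))) (k : Fin d → ℤ) :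
    coeff (fun x => L (f x)) k = L (coeff f k) := by
  have hi : Integrable (fun x => wave k x • f x) (volume.restrict (cell d)) :=
    hf.bdd_smul 1 (continuous_wave k).aestronglyMeasurable
      (Eventually.of_forall fun x => (norm_wave k x).le)
  rw [coeff, coeff, map_smul, ← L.integral_comp_comm hi]
  simp

theorem coeff_tsum {E : Type*} [NormedAddCommGroup E] [NormedSpace ℂ E] [CompleteSpace E]
    {F : (Fin d → ℤ) → (Fin d → ℝ) → E} (hF : ∀ j, Integrable (F j) (volume.restrict (cell d)))
    (hs : Summable fun j => ∫ x in cell d, ‖F j x‖) (k : Fin d → ℤ) :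
    coeff (fun x => ∑' j, F j x) k = ∑' j, coeff (F j) k := by
  have hi : ∀ j, Integrable (fun x => wave k x • F j x) (volume.restrict (cell d)) := fun j =>
    (hF j).bdd_smul 1 (continuous_wave k).aestronglyMeasurable
      (Eventually.of_forall fun x => (norm_wave k x).le)
  have h := integral_tsum_of_summable_integral_norm hi
    (by simpa only [norm_smul, norm_wave, one_mul] using hs)
  simp only [coeff]
  rw [tsum_const_smul'', h]
  simp only [tsum_const_smul'']

theorem integrable_L2Field (u : L2Field d) : Integrable u (volume.restrict (cell d)) :=
  (Lp.memLp u).integrable (by norm_num)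

theorem eq_of_coeff_eq {u v : L2Field d} (h : ∀ k, coeff u k = coeff v k) : u = v := by
  rw [← sub_eq_zero]
  set w := u - v with hw
  have hw0 : ∀ k, coeff w k = 0 := by
    intro k
    have : coeff u k = coeff w k + coeff v k := by rw [← coeff_add, hw, sub_add_cancel]
    rw [h k] at this
    simpa using this
  have hi : ∀ i : Fin d, ∀ᵐ x ∂(volume.restrict (cell d)), w x i = 0 := by
    intro i
    have hL : ∀ x, w x i = (EuclideanSpace.proj i : Amp d →L[ℂ] ℂ) (w x) := fun x => rfl
    refine ae_eq_zero_of_coeff_eq_zero (f := fun x => w x i) ?_ ?_ ?_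
    · exact (EuclideanSpace.proj i : Amp d →L[ℂ] ℂ).continuous.comp_stronglyMeasurable
        (Lp.stronglyMeasurable w)
    · exact (EuclideanSpace.proj i : Amp d →L[ℂ] ℂ).comp_memLp' (Lp.memLp w)
    · intro k
      simp only [hL]
      rw [coeff_comp_clm _ (integrable_L2Field w), hw0 k, map_zero]
  rw [Lp.eq_zero_iff_ae_eq_zero]
  filter_upwards [ae_all_iff.2 hi] with x hx
  ext i
  exact hx i

theorem hat_injective {u v : PhaseSpace d} (h : ∀ k, hat u k = hat v k) : u = v :=
  Subtype.ext (eq_of_coeff_eq h)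

/-- The function with Fourier coefficients `c`. -/
def fourierSeries {E : Type*} [NormedAddCommGroup E] [NormedSpace ℂ E] (c : (Fin d → ℤ) → E)
    (x : Fin d → ℝ) : E := ∑' j, wave (-j) x • c j

section FourierSeries

variable {E : Type*} [NormedAddCommGroup E] [NormedSpace ℂ E] {c : (Fin d → ℤ) → E}

theorem norm_fourierSeries_le (hc : Summable fun j => ‖c j‖) (x : Fin d → ℝ) :
    ‖fourierSeries c x‖ ≤ ∑' j, ‖c j‖ := by
  refine (norm_tsum_le_tsum_norm ?_).trans_eq ?_ <;> simp only [norm_smul, norm_wave, one_mul, hc]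

variable [CompleteSpace E]

theorem continuous_fourierSeries (hc : Summable fun j => ‖c j‖) :
    Continuous (fourierSeries c) := by
  refine continuous_tsum (fun j => (continuous_wave _).smul continuous_const) hc fun j x => ?_
  rw [norm_smul, norm_wave, one_mul]

theorem coeff_fourierSeries (hc : Summable fun j => ‖c j‖) (k : Fin d → ℤ) :
    coeff (fourierSeries c) k = c k := by
  have h := coeff_tsum (d := d) (F := fun j x => wave (-j) x • c j) (fun j => ?_) ?_ k
  · unfold fourierSeries
    rw [h]
    simp only [coeff_wave, tsum_ite_eq]
  · have : IntegrableOn (fun x => wave (-j) x • c j) (cell d) :=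
      ((continuous_wave _).smul continuous_const).continuousOn.integrableOn_compact isCompact_Icc
    exact this
  · simp only [norm_smul, norm_wave, one_mul, setIntegral_const, smul_eq_mul]
    exact hc.mul_left _

end FourierSeries

/-- The series is bounded, hence in `L²`, and has the same coefficients as `u`. This pointwise
expansion is what lets products be computed mode by mode. -/
theorem ae_eq_fourierSeries (u : L2Field d) (hc : Summable fun j => ‖coeff u j‖) :
    u =ᵐ[volume.restrict (cell d)] fourierSeries (coeff u) := by
  have hm : MemLp (fourierSeries (coeff u)) 2 (volume.restrict (cell d)) :=
    MemLp.of_bound (continuous_fourierSeries hc).aestronglyMeasurable _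
      (Eventually.of_forall (norm_fourierSeries_le hc))
  have : u = hm.toLp := by
    refine eq_of_coeff_eq fun k => ?_
    rw [← coeff_fourierSeries hc k]
    exact coeff_congr_ae hm.coeFn_toLp.symm k
  conv_lhs => rw [this]
  exact hm.coeFn_toLp

theorem coeff_mul_smul (c : ℂ) (v : L2Field d) (j k : Fin d → ℤ) :
    coeff (fun x => (wave (-j) x * c) • v x) k = c • coeff v (k - j) := by
  unfold coeff
  rw [smul_comm c, ← integral_smul c]
  refine congrArg _ (integral_congr_ae (Eventually.of_forall fun x => ?_))
  dsimp only
  rw [sub_eq_add_neg, wave_add, smul_smul, smul_smul]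
  congr 1
  ring

theorem coeff_scalarSeries_smul {c : (Fin d → ℤ) → ℂ} (hc : Summable fun j => ‖c j‖)
    (v : L2Field d) (k : Fin d → ℤ) :
    coeff (fun x => ∑' j, (wave (-j) x * c j) • v x) k = ∑' j, c j • coeff v (k - j) := by
  have hn : ∀ j x, ‖wave (-j) x * c j‖ = ‖c j‖ := fun j x => by
    rw [norm_mul, norm_wave, one_mul]
  have hi : ∀ j, Integrable (fun x => (wave (-j) x * c j) • v x) (volume.restrict (cell d)) :=
    fun j => (integrable_L2Field v).bdd_smul (φ := fun x => wave (-j) x * c j) ‖c j‖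
      ((continuous_wave (-j)).mul continuous_const).aestronglyMeasurable
      (Eventually.of_forall fun x => (hn j x).le)
  rw [coeff_tsum hi]
  · exact tsum_congr fun j => coeff_mul_smul _ v j k
  · simp only [norm_smul, hn, integral_const_mul]
    exact hc.mul_right _

/-- The Fourier coefficients of a product are the convolution of the Fourier coefficients. -/
theorem coeff_component_smul (u v : L2Field d) (hu : Summable fun j => ‖coeff u j‖) (m : Fin d)
    (k : Fin d → ℤ) :
    coeff (fun x => u x m • v x) k = ∑' j, coeff u j m • coeff v (k - j) := by
  have h1 : coeff (fun x => u x m • v x) k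
      = coeff (fun x => ∑' j, (wave (-j) x * coeff u j m) • v x) k := by
    refine coeff_congr_ae ?_ k
    filter_upwards [ae_eq_fourierSeries u hu] with x hx
    have hs : Summable fun j => wave (-j) x • coeff u j := by
      refine Summable.of_norm ?_
      simpa only [norm_smul, norm_wave, one_mul] using hu
    have h2 : u x m = ∑' j, wave (-j) x * coeff u j m := by
      rw [hx, fourierSeries]
      exact (EuclideanSpace.proj m : Amp d →L[ℂ] ℂ).map_tsum hs
    have h3 : Summable fun j => wave (-j) x * coeff u j m :=
      (EuclideanSpace.proj m : Amp d →L[ℂ] ℂ).summable hs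
    rw [h2]
    exact tsum_smul_amp h3 (v x)
  rw [h1]
  exact coeff_scalarSeries_smul (c := fun j => coeff u j m) (Summable.of_nonneg_of_le
    (fun _ => norm_nonneg _) (fun j => PiLp.norm_apply_le (coeff u j) m) hu) v k

end Coefficients

/-! ### The Leray symbol and the nonlinearity on Fourier amplitudes. -/

section Symbol

variable {d : ℕ}

/-- A wave vector as a complex vector. -/
def waveVec (k : Fin d → ℤ) : Amp d := WithLp.toLp 2 (fun i => (k i : ℂ))

theorem norm_waveVec (k : Fin d → ℤ) : ‖waveVec k‖ = len k := by
  simp [waveVec, EuclideanSpace.norm_eq, len]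

theorem inner_waveVec (k : Fin d → ℤ) (w : Amp d) :
    inner ℂ (waveVec k) w = ∑ i, (k i : ℂ) * w i := by
  simp [waveVec, PiLp.inner_apply, mul_comm]

theorem len_sq (k : Fin d → ℤ) : (∑ i, (k i : ℂ) ^ 2) = ((len k ^ 2 : ℝ) : ℂ) := by
  rw [len, Real.sq_sqrt (by positivity)]
  push_cast
  rfl

theorem leray_eq (k : Fin d → ℤ) (w : Amp d) :
    leray k w = w - (inner ℂ (waveVec k) w / ((len k ^ 2 : ℝ) : ℂ)) • waveVec k := by
  rw [leray, len_sq, inner_waveVec, waveVec]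

theorem len_nonneg (k : Fin d → ℤ) : 0 ≤ len k := Real.sqrt_nonneg _

theorem len_zero : len (0 : Fin d → ℤ) = 0 := by simp [len]

theorem len_add_le (j k : Fin d → ℤ) : len (j + k) ≤ len j + len k := by
  simp only [← norm_waveVec]
  have h : waveVec (j + k) = waveVec j + waveVec k := by
    ext i
    simp [waveVec]
  rw [h]
  exact norm_add_le _ _

theorem one_le_len {k : Fin d → ℤ} (hk : k ≠ 0) : 1 ≤ len k := by
  obtain ⟨i, hi⟩ := Function.ne_iff.1 hk
  rw [len, Real.one_le_sqrt]
  have h1 : (1 : ℝ) ≤ (k i : ℝ) ^ 2 := by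
    have : (1 : ℤ) ≤ k i ^ 2 := by
      have : 0 < k i ^ 2 := sq_pos_of_ne_zero hi
      lia
    exact_mod_cast this
  exact h1.trans (Finset.single_le_sum (f := fun i => (k i : ℝ) ^ 2) (fun i _ => by positivity)
    (Finset.mem_univ i))

theorem abs_le_len (k : Fin d → ℤ) (i : Fin d) : |(k i : ℝ)| ≤ len k := by
  rw [len, ← Real.sqrt_sq_eq_abs]
  exact Real.sqrt_le_sqrt (Finset.single_le_sum (f := fun i => (k i : ℝ) ^ 2)
    (fun i _ => by positivity) (Finset.mem_univ i))

/-- The triangle inequality and Cauchy–Schwarz give the crude constant 2, which suffices. -/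
theorem norm_leray_le (k : Fin d → ℤ) (w : Amp d) : ‖leray k w‖ ≤ 2 * ‖w‖ := by
  rw [leray_eq, two_mul]
  refine (norm_sub_le _ _).trans (add_le_add_right ?_ _)
  rw [norm_smul, norm_div, norm_waveVec, Complex.norm_real, Real.norm_of_nonneg (by positivity)]
  rcases (len_nonneg k).eq_or_lt with h | h
  · rw [← h]; simp
  · have := norm_inner_le_norm (𝕜 := ℂ) (waveVec k) w
    rw [norm_waveVec] at this
    rw [div_mul_eq_mul_div, div_le_iff₀ (by positivity)]
    nlinarith

/-- The Leray-Helmholtz symbol as a continuous linear map. -/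
def lerayCLM (k : Fin d → ℤ) : Amp d →L[ℂ] Amp d :=
  LinearMap.mkContinuous
    { toFun := leray k
      map_add' := fun v w => by
        simp only [leray_eq, inner_add_right, add_div, add_smul]; abel
      map_smul' := fun c w => by
        simp only [leray_eq, inner_smul_right, mul_div_assoc, mul_smul, smul_sub,
          RingHom.id_apply] }
    2 (norm_leray_le k)

theorem lerayCLM_apply (k : Fin d → ℤ) (w : Amp d) : lerayCLM k w = leray k w := rfl

theorem inner_leray (k : Fin d → ℤ) (w : Amp d) : inner ℂ (waveVec k) (leray k w) = 0 := by
  rw [leray_eq, inner_sub_right, inner_smul_right, inner_self_eq_norm_sq_to_K, norm_waveVec]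
  rcases (len_nonneg k).eq_or_lt with h | h
  · have : waveVec k = 0 := by rw [← norm_eq_zero, norm_waveVec, h]
    simp [this, ← h]
  · have h' : (len k : ℂ) ≠ 0 := by exact_mod_cast h.ne'
    push_cast
    simp only [RCLike.ofReal_eq_complex_ofReal]
    field_simp
    ring

theorem leray_of_inner_eq_zero {k : Fin d → ℤ} {w : Amp d} (h : inner ℂ (waveVec k) w = 0) :
    leray k w = w := by
  rw [leray_eq, h]; simp

/-- The projection of Fourier amplitudes onto the divergence free ones of mean zero. -/
def modeProj (k : Fin d → ℤ) : Amp d →L[ℂ] Amp d := if k = 0 then 0 else lerayCLM k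

theorem norm_modeProj_le (k : Fin d → ℤ) (w : Amp d) : ‖modeProj k w‖ ≤ 2 * ‖w‖ := by
  unfold modeProj
  split_ifs
  · simp
  · exact norm_leray_le k w

theorem inner_modeProj (k : Fin d → ℤ) (w : Amp d) : inner ℂ (waveVec k) (modeProj k w) = 0 := by
  unfold modeProj
  split_ifs
  · simp
  · exact inner_leray k w

theorem modeProj_hat (u : PhaseSpace d) (k : Fin d → ℤ) : modeProj k (hat u k) = hat u k := by
  unfold modeProj
  split_ifs with h
  · rw [h]; exact u.2.1.symm
  · exact leray_of_inner_eq_zero ((inner_waveVec k _).trans (u.2.2 k))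

/-- The contribution to the `k`-th mode of the Euler nonlinearity of two modes of given
amplitudes. -/
def modeBilin (k : Fin d → ℤ) : Amp d →L[ℂ] Amp d →L[ℂ] Amp d :=
  (ContinuousLinearMap.compL ℂ (Amp d) (Amp d) (Amp d) (lerayCLM k)).comp
    ((ContinuousLinearMap.lsmul ℂ ℂ).comp (Complex.I • innerSL ℂ (waveVec k)))

theorem modeBilin_apply (k : Fin d → ℤ) (a b : Amp d) :
    modeBilin k a b = leray k ((Complex.I * inner ℂ (waveVec k) a) • b) := rfl

theorem norm_modeBilin_le (k : Fin d → ℤ) (a b : Amp d) :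
    ‖modeBilin k a b‖ ≤ 2 * len k * ‖a‖ * ‖b‖ := by
  rw [modeBilin_apply]
  refine (norm_leray_le _ _).trans ?_
  rw [norm_smul, norm_mul, Complex.norm_I, one_mul, ← norm_waveVec, mul_assoc, mul_assoc,
    ← mul_assoc ‖waveVec k‖]
  gcongr
  exact norm_inner_le_norm _ _

/-- For `k = 0` the divergence supplies a factor `k` that kills the term; otherwise the output of
the Leray symbol is already orthogonal to `k`. -/
theorem modeProj_modeBilin (k : Fin d → ℤ) (a b : Amp d) :
    modeProj k (modeBilin k a b) = modeBilin k a b := by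
  unfold modeProj
  split_ifs with h
  · have : waveVec k = 0 := by rw [← norm_eq_zero, norm_waveVec, h, len_zero]
    rw [modeBilin_apply, this, inner_zero_left, mul_zero, zero_smul, ← lerayCLM_apply, map_zero,
      map_zero]
  · exact leray_of_inner_eq_zero (inner_leray k _)

/-- The Euler nonlinearity in terms of Fourier coefficients. -/
def conv (a b : (Fin d → ℤ) → Amp d) (k : Fin d → ℤ) : Amp d :=
  ∑' j, modeBilin k (a j) (b (k - j))

/-- The sum over `m` of `k m * hat u j m` collects into an inner product with `k`, and the Leray
symbol passes through the absolutely convergent sum. -/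
theorem nonlin_eq_conv (u v : PhaseSpace d) (hu : Summable fun j => ‖hat u j‖)
    (hv : Summable fun j => ‖hat v j‖) (k : Fin d → ℤ) :
    nonlin u v k = conv (hat u) (hat v) k := by
  have hsum : ∀ m : Fin d, Summable fun j => hat u j m • hat v (k - j) := by
    intro m
    refine Summable.of_norm_bounded (g := fun j => ‖hat u j‖ * ∑' l, ‖hat v l‖)
      (hu.mul_right _) fun j => ?_
    rw [norm_smul]
    exact mul_le_mul (PiLp.norm_apply_le _ _) (hv.le_tsum _ fun _ _ => norm_nonneg _)
      (norm_nonneg _) (norm_nonneg _)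
  have h1 : ∀ m : Fin d, (Complex.I * (k m : ℂ)) •
      coeff (fun x => ((u : L2Field d) x m) • ((v : L2Field d) x)) k
      = ∑' j, (Complex.I * (k m : ℂ)) • hat u j m • hat v (k - j) := by
    intro m
    rw [coeff_component_smul _ _ hu, tsum_const_smul'']
    rfl
  rw [nonlin, Finset.sum_congr rfl fun m _ => h1 m,
    ← Summable.tsum_finsetSum fun m _ => (hsum m).const_smul _, ← lerayCLM_apply,
    (lerayCLM k).map_tsum (summable_sum fun m _ => (hsum m).const_smul _)]
  refine tsum_congr fun j => ?_
  rw [modeBilin_apply, lerayCLM_apply, inner_waveVec, Finset.mul_sum, Finset.sum_smul]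
  congr 1
  refine Finset.sum_congr rfl fun m _ => ?_
  rw [smul_smul, mul_assoc]

end Symbol

/-! ### Summability of exponential weights over the lattice. -/

section Lattice

theorem summable_exp_neg_mul_abs_int {c : ℝ} (hc : 0 < c) :
    Summable fun n : ℤ => Real.exp (-(c * |(n : ℝ)|)) := by
  have h : Summable fun n : ℕ => Real.exp (-(c * |(n : ℝ)|)) := by
    refine (summable_geometric_of_lt_one (Real.exp_pos (-c)).le
      (Real.exp_lt_one_iff.2 (neg_lt_zero.2 hc))).congr fun n => ?_
    rw [← Real.exp_nat_mul, Nat.abs_cast]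
    ring_nf
  refine Summable.of_nat_of_neg ?_ ?_ <;> simpa using h

theorem summable_prod_pi {f : ℤ → ℝ} (hf0 : ∀ n, 0 ≤ f n) (hf : Summable f) (d : ℕ) :
    Summable fun k : Fin d → ℤ => ∏ i, f (k i) := by
  induction d with
  | zero => exact Summable.of_finite
  | succ d ih =>
    rw [← (Fin.consEquiv fun _ => ℤ).summable_iff]
    refine (hf.mul_of_nonneg ih hf0 fun k => Finset.prod_nonneg fun i _ => hf0 _).congr fun p => ?_
    simp [Fin.prod_univ_succ, Fin.consEquiv]

theorem summable_exp_neg_mul_len {d : ℕ} {c : ℝ} (hc : 0 < c) :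
    Summable fun k : Fin d → ℤ => Real.exp (-(c * len k)) := by
  -- The sum of the `|k i|` is at most `d * len k`; dividing by `d + 1` instead of `d` avoids a case
  -- split at `d = 0`.
  have hd : (0 : ℝ) < d + 1 := by positivity
  refine Summable.of_nonneg_of_le (fun _ => (Real.exp_pos _).le) (fun k => ?_)
    (summable_prod_pi (fun _ => (Real.exp_pos _).le)
      (summable_exp_neg_mul_abs_int (div_pos hc hd)) d)
  rw [← Real.exp_sum, Real.exp_le_exp, Finset.sum_neg_distrib, neg_le_neg_iff, ← Finset.mul_sum]
  have h : ∑ i, |(k i : ℝ)| ≤ d * len k := by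
    simpa using Finset.sum_le_card_nsmul Finset.univ _ (len k) fun i _ => abs_le_len k i
  rw [div_mul_eq_mul_div, div_le_iff₀ hd, mul_assoc]
  have := len_nonneg k
  gcongr
  linarith

end Lattice

/-! ### Cauchy–Kovalevskaya bounds for the formal Taylor coefficients. -/

section Majorant

variable {d : ℕ}

/-- The norm of the weighted Wiener algebra of Fourier coefficients. -/
def wienerNorm (β : ℝ) (a : (Fin d → ℤ) → Amp d) : ℝ≥0∞ :=
  ∑' k, ENNReal.ofReal (Real.exp (β * len k)) * ‖a k‖ₑ

/-- The derivative is absorbed by `x ≤ exp (δ x) / δ` with `δ = β - β'`; the remaining weight splits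
over `j` and `k - j` by the triangle inequality for `len`. -/
theorem exp_mul_norm_modeBilin_le {β β' : ℝ} (h : β' < β) (hβ : 0 ≤ β) (j k : Fin d → ℤ)
    (x y : Amp d) :
    Real.exp (β' * len k) * ‖modeBilin k x y‖ ≤
      2 / (β - β') * ((Real.exp (β * len j) * ‖x‖) * (Real.exp (β * len (k - j)) * ‖y‖)) := by
  have hδ : 0 < β - β' := sub_pos.2 h
  have h1 : Real.exp (β' * len k) * len k ≤ 1 / (β - β') * Real.exp (β * len k) := by
    have h2 := (Real.add_one_le_exp ((β - β') * len k)).trans' (le_add_of_nonneg_right zero_le_one)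
    have h3 : Real.exp (β * len k) = Real.exp (β' * len k) * Real.exp ((β - β') * len k) := by
      rw [← Real.exp_add]; ring_nf
    rw [h3, one_div, mul_left_comm]
    gcongr
    rw [← div_eq_inv_mul, le_div_iff₀ hδ, mul_comm]
    exact h2
  have h4 : Real.exp (β * len k) ≤ Real.exp (β * len j) * Real.exp (β * len (k - j)) := by
    rw [← Real.exp_add, ← mul_add]
    gcongr
    simpa using len_add_le j (k - j)
  calc Real.exp (β' * len k) * ‖modeBilin k x y‖
      ≤ Real.exp (β' * len k) * (2 * len k * ‖x‖ * ‖y‖) := by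
        gcongr; exact norm_modeBilin_le k x y
    _ = 2 * (Real.exp (β' * len k) * len k) * (‖x‖ * ‖y‖) := by ring
    _ ≤ 2 * (1 / (β - β') * (Real.exp (β * len j) * Real.exp (β * len (k - j))))
          * (‖x‖ * ‖y‖) := by
        exact mul_le_mul_of_nonneg_right (mul_le_mul_of_nonneg_left
          (h1.trans (mul_le_mul_of_nonneg_left h4 (by positivity))) zero_le_two) (by positivity)
    _ = _ := by ring

theorem wienerNorm_conv_le {β β' : ℝ} (h : β' < β) (hβ : 0 ≤ β) (a b : (Fin d → ℤ) → Amp d) :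
    wienerNorm β' (conv a b) ≤
      ENNReal.ofReal (2 / (β - β')) * (wienerNorm β a * wienerNorm β b) := by
  have hδ : 0 < β - β' := sub_pos.2 h
  have h1 : ∀ k j, ENNReal.ofReal (Real.exp (β' * len k)) * ‖modeBilin k (a j) (b (k - j))‖ₑ ≤
      ENNReal.ofReal (2 / (β - β')) * ((ENNReal.ofReal (Real.exp (β * len j)) * ‖a j‖ₑ) *
        (ENNReal.ofReal (Real.exp (β * len (k - j))) * ‖b (k - j)‖ₑ)) := by
    intro k j
    simp only [← ofReal_norm]
    rw [← ENNReal.ofReal_mul (by positivity), ← ENNReal.ofReal_mul (by positivity),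
      ← ENNReal.ofReal_mul (by positivity), ← ENNReal.ofReal_mul (by positivity),
      ← ENNReal.ofReal_mul (by positivity)]
    exact ENNReal.ofReal_le_ofReal (exp_mul_norm_modeBilin_le h hβ j k _ _)
  calc wienerNorm β' (conv a b)
      ≤ ∑' k, ∑' j, ENNReal.ofReal (Real.exp (β' * len k)) *
          ‖modeBilin k (a j) (b (k - j))‖ₑ := by
        refine ENNReal.tsum_le_tsum fun k => ?_
        rw [ENNReal.tsum_mul_left]
        gcongr
        -- No summability is required: a divergent `tsum` is 0, and the right side lives in `[0,
        -- ∞]`.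
        exact enorm_tsum_le_tsum_enorm
    _ ≤ ∑' k, ∑' j, ENNReal.ofReal (2 / (β - β')) *
          ((ENNReal.ofReal (Real.exp (β * len j)) * ‖a j‖ₑ) *
          (ENNReal.ofReal (Real.exp (β * len (k - j))) * ‖b (k - j)‖ₑ)) :=
        ENNReal.tsum_le_tsum fun k => ENNReal.tsum_le_tsum fun j => h1 k j
    _ = _ := by
        rw [ENNReal.tsum_comm]
        simp only [ENNReal.tsum_mul_left]
        congr 1
        unfold wienerNorm
        rw [← ENNReal.tsum_mul_right]
        refine tsum_congr fun j => ?_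
        congr 1
        exact (Equiv.subRight j).tsum_eq
          fun l => ENNReal.ofReal (Real.exp (β * len l)) * ‖b l‖ₑ

theorem wienerNorm_smul (β : ℝ) (c : ℂ) (a : (Fin d → ℤ) → Amp d) :
    wienerNorm β (fun k => c • a k) = ‖c‖ₑ * wienerNorm β a := by
  unfold wienerNorm
  rw [← ENNReal.tsum_mul_left]
  refine tsum_congr fun k => ?_
  rw [enorm_smul, mul_left_comm]

theorem wienerNorm_sum_le {ι : Type*} (s : Finset ι) (β : ℝ) (a : ι → (Fin d → ℤ) → Amp d) :
    wienerNorm β (fun k => ∑ i ∈ s, a i k) ≤ ∑ i ∈ s, wienerNorm β (a i) := by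
  unfold wienerNorm
  rw [← Summable.tsum_finsetSum fun _ _ => ENNReal.summable]
  refine ENNReal.tsum_le_tsum fun k => ?_
  rw [← Finset.mul_sum]
  gcongr
  exact enorm_sum_le _ _

/-- The Taylor coefficients in time of the solution of the Euler equation with initial Fourier
coefficients `a`. -/
def taylor (a : (Fin d → ℤ) → Amp d) : ℕ → (Fin d → ℤ) → Amp d
  | 0 => a
  | n + 1 => fun k => (-((n : ℂ) + 1)⁻¹) •
      ∑ i : Fin (n + 1), conv (taylor a i) (taylor a (n - i)) k
  decreasing_by
    · exact i.2
    · lia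

theorem taylor_zero (a : (Fin d → ℤ) → Amp d) : taylor a 0 = a := by rw [taylor]

theorem taylor_succ (a : (Fin d → ℤ) → Amp d) (n : ℕ) :
    taylor a (n + 1) = fun k => (-((n : ℂ) + 1)⁻¹) •
      ∑ p ∈ Finset.HasAntidiagonal.antidiagonal n, conv (taylor a p.1) (taylor a p.2) k := by
  rw [taylor]
  ext1 k
  rw [Finset.Nat.sum_antidiagonal_eq_sum_range_succ
    (fun i j => conv (taylor a i) (taylor a j) k), Finset.sum_range]

theorem sum_antidiagonal_conv_taylor (a : (Fin d → ℤ) → Amp d) (n : ℕ) (k : Fin d → ℤ) :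
    ∑ p ∈ Finset.HasAntidiagonal.antidiagonal n, conv (taylor a p.1) (taylor a p.2) k
      = -(((n : ℂ) + 1) • taylor a (n + 1) k) := by
  have : (n : ℂ) + 1 ≠ 0 := Nat.cast_add_one_ne_zero n
  rw [taylor_succ, smul_smul, mul_neg, mul_inv_cancel₀ this, neg_smul, one_smul, neg_neg]

theorem catalan_le_four_pow (n : ℕ) : (catalan n : ℝ) ≤ 4 ^ n := by
  have h1 : catalan n ≤ n.centralBinom := by
    rw [← succ_mul_catalan_eq_centralBinom]
    exact Nat.le_mul_of_pos_left _ n.succ_pos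
  have h2 : n.centralBinom ≤ 4 ^ n := by
    have : n.centralBinom ≤ 2 ^ (2 * n) := Nat.choose_le_two_pow _ _
    rwa [pow_mul] at this
  exact_mod_cast h1.trans h2

theorem one_add_inv_pow_le (n : ℕ) : (((n : ℝ) + 2) / (n + 1)) ^ n ≤ 3 := by
  have hn : (0 : ℝ) < (n : ℝ) + 1 := by positivity
  have h1 : ((n : ℝ) + 2) / (n + 1) ≤ Real.exp (1 / (n + 1)) := by
    refine le_trans (le_of_eq ?_) (Real.add_one_le_exp _)
    field_simp
    ring
  calc (((n : ℝ) + 2) / (n + 1)) ^ n ≤ Real.exp (1 / (n + 1)) ^ n := by gcongr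
    _ = Real.exp (n / (n + 1)) := by rw [← Real.exp_nat_mul]; ring_nf
    _ ≤ Real.exp 1 := by
        rw [Real.exp_le_exp, div_le_one hn]; linarith
    _ ≤ 3 := Real.exp_one_lt_three.le

/-- The Catalan recursion sums the convolution. The constant is `12 = 2 * 2 * 3`: 2 from the
bilinear estimate, 2 bounding `(n + 2) / (n + 1)`, and 3 bounding its `n`-th power. -/
theorem majorant_step {M s : ℝ} (hM : 0 ≤ M) (hs : 0 < s) (n : ℕ) :
    ((n : ℝ) + 1)⁻¹ * ∑ p ∈ Finset.HasAntidiagonal.antidiagonal n, 2 / (s / (n + 2)) *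
      ((M * (12 * M / (s * (n + 1) / (n + 2))) ^ p.1 * catalan p.1) *
        (M * (12 * M / (s * (n + 1) / (n + 2))) ^ p.2 * catalan p.2))
      ≤ M * (12 * M / s) ^ (n + 1) * catalan (n + 1) := by
  set q := 12 * M / (s * (n + 1) / (n + 2)) with hq
  have hsum : ∑ p ∈ Finset.HasAntidiagonal.antidiagonal n, 2 / (s / (n + 2)) *
      ((M * q ^ p.1 * catalan p.1) * (M * q ^ p.2 * catalan p.2))
      = 2 / (s / (n + 2)) * M ^ 2 * q ^ n * catalan (n + 1) := by
    rw [catalan_succ', Nat.cast_sum, Finset.mul_sum]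
    refine Finset.sum_congr rfl fun p hp => ?_
    rw [← Finset.HasAntidiagonal.mem_antidiagonal.1 hp, pow_add]
    push_cast
    ring
  have hqe : q = 12 * M / s * (((n : ℝ) + 2) / (n + 1)) := by
    rw [hq]; field_simp
  have h2 : ((n : ℝ) + 2) / (n + 1) ≤ 2 := by
    rw [div_le_iff₀ (by positivity)]
    linarith [(Nat.cast_nonneg n : (0 : ℝ) ≤ n)]
  rw [hsum, hqe, mul_pow]
  calc ((n : ℝ) + 1)⁻¹ * (2 / (s / (n + 2)) * M ^ 2 *
        ((12 * M / s) ^ n * (((n : ℝ) + 2) / (n + 1)) ^ n) * catalan (n + 1))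
      = 2 * M ^ 2 / s * (12 * M / s) ^ n * catalan (n + 1) *
        ((((n : ℝ) + 2) / (n + 1)) * (((n : ℝ) + 2) / (n + 1)) ^ n) := by
        field_simp
    _ ≤ 2 * M ^ 2 / s * (12 * M / s) ^ n * catalan (n + 1) * (2 * 3) := by
        gcongr
        exact one_add_inv_pow_le n
    _ = _ := by rw [pow_succ]; ring

/-- The loss `s` stays quantified inside the induction, because order `n + 1` at loss `s` calls on
lower orders at a smaller loss. -/
theorem wienerNorm_taylor_le_catalan {β M : ℝ} (hM : 0 ≤ M)
    {a : (Fin d → ℤ) → Amp d} (ha : wienerNorm β a ≤ ENNReal.ofReal M) (n : ℕ) :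
    ∀ s, 0 < s → s ≤ β → wienerNorm (β - s) (taylor a n) ≤
      ENNReal.ofReal (M * (12 * M / s) ^ n * catalan n) := by
  induction n using Nat.strong_induction_on with
  | _ n ih =>
  intro s hs hsβ
  cases n with
  | zero =>
    rw [taylor_zero]
    simp only [pow_zero, mul_one, catalan_zero, Nat.cast_one]
    refine le_trans (ENNReal.tsum_le_tsum fun k => ?_) ha
    gcongr
    · exact len_nonneg k
    · linarith
  | succ n =>
    -- The lower orders spend `s'` of the loss, leaving `s / (n + 2)` for the bilinear estimate. The
    -- resulting factor `n + 2` is compensated by `(n + 1)⁻¹` in the recursion.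
    set s' := s * (n + 1) / (n + 2) with hs'
    have hs'0 : 0 < s' := by positivity
    have hlt : s - s' = s / (n + 2) := by rw [hs']; field_simp; ring
    have hpos : 0 < s / ((n : ℝ) + 2) := by positivity
    have hs'β : s' ≤ β := by linarith
    have hδ : (β - s') - (β - s) = s / (n + 2) := by linarith
    rw [taylor_succ, wienerNorm_smul]
    have hc : ‖-((n : ℂ) + 1)⁻¹‖ₑ = ENNReal.ofReal (((n : ℝ) + 1)⁻¹) := by
      rw [← ofReal_norm, norm_neg, norm_inv]
      congr 2
      exact_mod_cast Complex.norm_natCast (n + 1)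
    rw [hc]
    have hb : ∀ p ∈ Finset.HasAntidiagonal.antidiagonal n,
        wienerNorm (β - s) (conv (taylor a p.1) (taylor a p.2)) ≤
        ENNReal.ofReal (2 / (s / (n + 2)) * ((M * (12 * M / s') ^ p.1 * catalan p.1) *
        (M * (12 * M / s') ^ p.2 * catalan p.2))) := by
      intro p hp
      have hp' := Finset.HasAntidiagonal.mem_antidiagonal.1 hp
      refine (wienerNorm_conv_le (β := β - s') (by linarith) (by linarith) _ _).trans ?_
      rw [hδ, ENNReal.ofReal_mul (by positivity), ENNReal.ofReal_mul (by positivity)]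
      gcongr
      · exact ih p.1 (by lia) s' hs'0 hs'β
      · exact ih p.2 (by lia) s' hs'0 hs'β
    calc ENNReal.ofReal (((n : ℝ) + 1)⁻¹) * wienerNorm (β - s)
          (fun k => ∑ p ∈ Finset.HasAntidiagonal.antidiagonal n, conv (taylor a p.1) (taylor a p.2) k)
        ≤ ENNReal.ofReal (((n : ℝ) + 1)⁻¹) * ∑ p ∈ Finset.HasAntidiagonal.antidiagonal n,
          ENNReal.ofReal (2 / (s / (n + 2)) * ((M * (12 * M / s') ^ p.1 * catalan p.1) *
          (M * (12 * M / s') ^ p.2 * catalan p.2))) := by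
          gcongr
          exact (wienerNorm_sum_le _ _ _).trans (Finset.sum_le_sum hb)
      _ = ENNReal.ofReal (((n : ℝ) + 1)⁻¹ * ∑ p ∈ Finset.HasAntidiagonal.antidiagonal n,
          2 / (s / (n + 2)) * ((M * (12 * M / s') ^ p.1 * catalan p.1) *
          (M * (12 * M / s') ^ p.2 * catalan p.2))) := by
          rw [ENNReal.ofReal_mul (by positivity),
            ENNReal.ofReal_sum_of_nonneg fun p _ => by positivity]
      _ ≤ _ := ENNReal.ofReal_le_ofReal (by simpa only [Nat.cast_add, Nat.cast_one] using majorant_step hM hs n)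

/-- Taking `s = β / 2` and bounding the Catalan number by `4 ^ n` gives `96 = 12 * 2 * 4`. -/
theorem wienerNorm_taylor_le {β M : ℝ} (hβ : 0 < β) (hM : 0 ≤ M)
    {a : (Fin d → ℤ) → Amp d} (ha : wienerNorm β a ≤ ENNReal.ofReal M) (n : ℕ) :
    wienerNorm (β / 2) (taylor a n) ≤ ENNReal.ofReal (M * (96 * M / β) ^ n) := by
  have h := wienerNorm_taylor_le_catalan hM ha n (β / 2) (by linarith) (by linarith)
  rw [sub_half] at h
  refine h.trans (ENNReal.ofReal_le_ofReal ?_)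
  calc M * (12 * M / (β / 2)) ^ n * catalan n ≤ M * (12 * M / (β / 2)) ^ n * 4 ^ n := by
        gcongr
        exact catalan_le_four_pow n
    _ = _ := by
        rw [mul_assoc, ← mul_pow]
        congr 2
        field_simp
        ring

theorem norm_le_of_wienerNorm_le {γ C : ℝ} (hC : 0 ≤ C) {a : (Fin d → ℤ) → Amp d}
    (ha : wienerNorm γ a ≤ ENNReal.ofReal C) (k : Fin d → ℤ) :
    ‖a k‖ ≤ C * Real.exp (-(γ * len k)) := by
  have h := (ENNReal.le_tsum k).trans ha
  rw [← ofReal_norm, ← ENNReal.ofReal_mul (by positivity), ENNReal.ofReal_le_ofReal_iff hC] at h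
  rw [Real.exp_neg, ← div_eq_mul_inv, le_div_iff₀ (by positivity), mul_comm]
  exact h

theorem modeProj_taylor {a : (Fin d → ℤ) → Amp d} (ha : ∀ k, modeProj k (a k) = a k)
    (hs : ∀ p q k, Summable fun j => modeBilin k (taylor a p j) (taylor a q (k - j)))
    (n : ℕ) (k : Fin d → ℤ) : modeProj k (taylor a n k) = taylor a n k := by
  cases n with
  | zero => rw [taylor_zero, ha]
  | succ n =>
    rw [taylor_succ, map_smul, map_sum]
    congr 1
    refine Finset.sum_congr rfl fun p _ => ?_
    rw [conv, ContinuousLinearMap.map_tsum _ (hs _ _ _)]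
    simp only [modeProj_modeBilin]

end Majorant

/-! ### Formal Taylor coefficients as genuine time derivatives; independence of the centre. -/

section TimeDerivative

variable {d : ℕ}

/-- Decay of one factor already gives a summable majorant in `j`; the other is only bounded. -/
theorem norm_modeBilin_le_of_decay {γ C D : ℝ} (hγ : 0 < γ) (hC : 0 ≤ C) (hD : 0 ≤ D)
    {a b : (Fin d → ℤ) → Amp d}
    (ha : ∀ j, ‖a j‖ ≤ C * Real.exp (-(γ * len j)))
    (hb : ∀ j, ‖b j‖ ≤ D * Real.exp (-(γ * len j))) (k j : Fin d → ℤ) :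
    ‖modeBilin k (a j) (b (k - j))‖ ≤ 2 * len k * C * D * Real.exp (-(γ * len j)) := by
  have hb' : ‖b (k - j)‖ ≤ D := by
    refine (hb _).trans (mul_le_of_le_one_right hD (Real.exp_le_one_iff.2 ?_))
    have := len_nonneg (k - j)
    rw [neg_nonpos]
    positivity
  have := len_nonneg k
  calc ‖modeBilin k (a j) (b (k - j))‖ ≤ 2 * len k * ‖a j‖ * ‖b (k - j)‖ :=
        norm_modeBilin_le _ _ _
    _ ≤ 2 * len k * (C * Real.exp (-(γ * len j))) * D := by
        gcongr
        exact ha j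
    _ = _ := by ring

theorem summable_modeBilin_of_decay {γ C D : ℝ} (hγ : 0 < γ) (hC : 0 ≤ C) (hD : 0 ≤ D)
    {a b : (Fin d → ℤ) → Amp d}
    (ha : ∀ j, ‖a j‖ ≤ C * Real.exp (-(γ * len j)))
    (hb : ∀ j, ‖b j‖ ≤ D * Real.exp (-(γ * len j))) (k : Fin d → ℤ) :
    Summable fun j => modeBilin k (a j) (b (k - j)) :=
  Summable.of_norm_bounded ((summable_exp_neg_mul_len hγ).mul_left _)
    (norm_modeBilin_le_of_decay hγ hC hD ha hb k)

theorem hasDerivAt_modeBilin {f g : ℝ → Amp d} {f' g' : Amp d} {t : ℝ} (hf : HasDerivAt f f' t)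
    (hg : HasDerivAt g g' t) (k : Fin d → ℤ) :
    HasDerivAt (fun s => modeBilin k (f s) (g s))
      (modeBilin k f' (g t) + modeBilin k (f t) g') t := by
  have h := ((modeBilin k).isBoundedBilinearMap.hasFDerivAt (f t, g t)).restrictScalars ℝ
  refine (h.comp_hasDerivAt (f := fun s => (f s, g s)) t (hf.prodMk hg)).congr_deriv ?_
  simp [add_comm]

theorem hasDerivAt_conv {I : Set ℝ} (hI : IsOpen I) (hI' : IsPreconnected I) {γ C : ℝ}
    (hγ : 0 < γ) (hC : 0 ≤ C) {f g f' g' : ℝ → (Fin d → ℤ) → Amp d}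
    (hf : ∀ s ∈ I, ∀ j, ‖f s j‖ ≤ C * Real.exp (-(γ * len j)))
    (hg : ∀ s ∈ I, ∀ j, ‖g s j‖ ≤ C * Real.exp (-(γ * len j)))
    (hf' : ∀ s ∈ I, ∀ j, ‖f' s j‖ ≤ C * Real.exp (-(γ * len j)))
    (hg' : ∀ s ∈ I, ∀ j, ‖g' s j‖ ≤ C * Real.exp (-(γ * len j)))
    (hdf : ∀ s ∈ I, ∀ j, HasDerivAt (fun x => f x j) (f' s j) s)
    (hdg : ∀ s ∈ I, ∀ j, HasDerivAt (fun x => g x j) (g' s j) s) {t : ℝ} (ht : t ∈ I)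
    (k : Fin d → ℤ) :
    HasDerivAt (fun s => conv (f s) (g s) k) (conv (f' t) (g t) k + conv (f t) (g' t) k) t := by
  have h := hasDerivAt_tsum_of_isPreconnected
    (g := fun j s => modeBilin k (f s j) (g s (k - j)))
    (g' := fun j s => modeBilin k (f' s j) (g s (k - j)) + modeBilin k (f s j) (g' s (k - j)))
    (u := fun j => 2 * (2 * len k * C * C * Real.exp (-(γ * len j))))
    (((summable_exp_neg_mul_len hγ).mul_left _).mul_left _) hI hI'
    (fun j s hs => hasDerivAt_modeBilin (hdf s hs j) (hdg s hs (k - j)) k)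
    (fun j s hs => by
      rw [two_mul]
      exact (norm_add_le _ _).trans (add_le_add
        (norm_modeBilin_le_of_decay hγ hC hC (hf' s hs) (hg s hs) k j)
        (norm_modeBilin_le_of_decay hγ hC hC (hf s hs) (hg' s hs) k j)))
    ht (summable_modeBilin_of_decay hγ hC hC (hf t ht) (hg t ht) k) ht
  refine h.congr_deriv ?_
  exact Summable.tsum_add (summable_modeBilin_of_decay hγ hC hC (hf' t ht) (hg t ht) k)
    (summable_modeBilin_of_decay hγ hC hC (hf t ht) (hg' t ht) k)

theorem conv_smul_left (c : ℂ) (a b : (Fin d → ℤ) → Amp d) (k : Fin d → ℤ) :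
    conv (fun j => c • a j) b k = c • conv a b k := by
  simp only [conv, map_smul, smul_apply, tsum_const_smul'']

theorem conv_smul_right (c : ℂ) (a b : (Fin d → ℤ) → Amp d) (k : Fin d → ℤ) :
    conv a (fun j => c • b j) k = c • conv a b k := by
  simp only [conv, map_smul, tsum_const_smul'']

/-- Leibniz rule for the recursion, with `D i j` standing for the nonlinearity at orders `i` and
`j`. After an index shift the two weights become `i` and `j`, the new boundary terms carry weight 0,
and `i + j = n + 1`. -/
theorem sum_antidiagonal_derivation {E : Type*} [AddCommGroup E] [Module ℂ E] (D : ℕ → ℕ → E)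
    (n : ℕ) :
    ∑ p ∈ Finset.HasAntidiagonal.antidiagonal n,
      (((p.1 : ℂ) + 1) • D (p.1 + 1) p.2 + ((p.2 : ℂ) + 1) • D p.1 (p.2 + 1))
      = ((n : ℂ) + 1) • ∑ p ∈ Finset.HasAntidiagonal.antidiagonal (n + 1), D p.1 p.2 := by
  have h1 := Finset.Nat.sum_antidiagonal_succ (n := n) (f := fun p => (p.1 : ℂ) • D p.1 p.2)
  have h2 := Finset.Nat.sum_antidiagonal_succ' (n := n) (f := fun p => (p.2 : ℂ) • D p.1 p.2)
  simp only [Nat.cast_zero, zero_smul, zero_add, Nat.cast_add, Nat.cast_one] at h1 h2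
  rw [Finset.sum_add_distrib, ← h1, ← h2, ← Finset.sum_add_distrib, Finset.smul_sum]
  refine Finset.sum_congr rfl fun p hp => ?_
  rw [← add_smul]
  congr 1
  exact_mod_cast congrArg (Nat.cast : ℕ → ℂ) (Finset.HasAntidiagonal.mem_antidiagonal.1 hp)

/-- A family of Fourier coefficients solving the Euler equation on an open set of times, all of
whose Taylor coefficients decay exponentially, uniformly in time. -/
structure AnalyticFlow (I : Set ℝ) (γ M R : ℝ) (a : ℝ → (Fin d → ℤ) → Amp d) : Prop where
  isOpen : IsOpen I
  convex : Convex ℝ I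
  decay_pos : 0 < γ
  nonneg : 0 ≤ M
  rate_pos : 0 < R
  hasDeriv : ∀ t ∈ I, ∀ k, HasDerivAt (fun s => a s k) (-conv (a t) (a t) k) t
  bound : ∀ t ∈ I, ∀ n k, ‖taylor (a t) n k‖ ≤ M * R ^ n * Real.exp (-(γ * len k))
  proj : ∀ t ∈ I, ∀ k, modeProj k (a t k) = a t k

namespace AnalyticFlow

variable {I : Set ℝ} {γ M R : ℝ} {a : ℝ → (Fin d → ℤ) → Amp d} (h : AnalyticFlow I γ M R a)

include h

theorem isPreconnected : IsPreconnected I := h.convex.isPreconnected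

/-- By iteration, `taylor (a t) n` is the `n`-th time derivative divided by `n!`. Strong induction
is used since the recursion involves all lower orders. -/
theorem hasDerivAt_taylor (n : ℕ) : ∀ t ∈ I, ∀ k,
    HasDerivAt (fun s => taylor (a s) n k) (((n : ℂ) + 1) • taylor (a t) (n + 1) k) t := by
  have hM := h.nonneg
  have hR := h.rate_pos
  induction n using Nat.strong_induction_on with
  | _ n ih =>
  intro t ht k
  cases n with
  | zero =>
    have h0 := sum_antidiagonal_conv_taylor (a t) 0 k
    simp only [Finset.HasAntidiagonal.antidiagonal_zero, Finset.sum_singleton, taylor_zero] at h0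
    rw [← neg_eq_iff_eq_neg] at h0
    rw [← h0]
    simpa only [taylor_zero] using h.hasDeriv t ht k
  | succ n =>
    have hb : ∀ p ∈ Finset.HasAntidiagonal.antidiagonal n,
        HasDerivAt (fun s => conv (taylor (a s) p.1) (taylor (a s) p.2) k)
          (((p.1 : ℂ) + 1) • conv (taylor (a t) (p.1 + 1)) (taylor (a t) p.2) k +
            ((p.2 : ℂ) + 1) • conv (taylor (a t) p.1) (taylor (a t) (p.2 + 1)) k) t := by
      intro p hp
      have hp' := Finset.HasAntidiagonal.mem_antidiagonal.1 hp
      set c : ℕ → ℝ := fun m => M * R ^ m with hc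
      have hc0 : ∀ m, 0 ≤ c m := fun m => by positivity
      -- A single constant dominating both factors and both derivatives, as `hasDerivAt_conv` asks.
      set C := c p.1 + c p.2 + (p.1 + 1) * c (p.1 + 1) + (p.2 + 1) * c (p.2 + 1) with hCdef
      have e1 := hc0 p.1
      have e2 := hc0 p.2
      have e3 : 0 ≤ ((p.1 : ℝ) + 1) * c (p.1 + 1) := by positivity
      have e4 : 0 ≤ ((p.2 : ℝ) + 1) * c (p.2 + 1) := by positivity
      have hT : ∀ m, ∀ s ∈ I, ∀ j, c m ≤ C →
          ‖taylor (a s) m j‖ ≤ C * Real.exp (-(γ * len j)) := fun m s hs j hm =>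
        (h.bound s hs m j).trans (by gcongr)
      have hT' : ∀ m : ℕ, ∀ s ∈ I, ∀ j, ((m : ℝ) + 1) * c (m + 1) ≤ C →
          ‖((m : ℂ) + 1) • taylor (a s) (m + 1) j‖ ≤ C * Real.exp (-(γ * len j)) := by
        intro m s hs j hm
        have hn : ‖(m : ℂ) + 1‖ = (m : ℝ) + 1 := by exact_mod_cast Complex.norm_natCast (m + 1)
        rw [norm_smul, hn]
        refine (mul_le_mul_of_nonneg_left (h.bound s hs (m + 1) j) (by positivity)).trans ?_
        rw [← mul_assoc]
        exact mul_le_mul_of_nonneg_right hm (Real.exp_pos _).le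
      have := hasDerivAt_conv h.isOpen h.isPreconnected h.decay_pos (C := C) (by linarith)
        (f := fun s => taylor (a s) p.1) (g := fun s => taylor (a s) p.2)
        (f' := fun s j => ((p.1 : ℂ) + 1) • taylor (a s) (p.1 + 1) j)
        (g' := fun s j => ((p.2 : ℂ) + 1) • taylor (a s) (p.2 + 1) j)
        (fun s hs j => hT p.1 s hs j (by linarith)) (fun s hs j => hT p.2 s hs j (by linarith))
        (fun s hs j => hT' p.1 s hs j (by linarith)) (fun s hs j => hT' p.2 s hs j (by linarith))
        (fun s hs j => ih p.1 (by lia) s hs j) (fun s hs j => ih p.2 (by lia) s hs j) ht k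
      rwa [conv_smul_left, conv_smul_right] at this
    have hs := (HasDerivAt.fun_sum hb).const_smul (-((n : ℂ) + 1)⁻¹)
    rw [sum_antidiagonal_derivation (fun p q => conv (taylor (a t) p) (taylor (a t) q) k),
      sum_antidiagonal_conv_taylor] at hs
    have hfun : (fun s => taylor (a s) (n + 1) k) = fun s => (-((n : ℂ) + 1)⁻¹) •
        ∑ p ∈ Finset.HasAntidiagonal.antidiagonal n,
          conv (taylor (a s) p.1) (taylor (a s) p.2) k := by
      simp only [taylor_succ (a _) n]
    rw [hfun]
    refine hs.congr_deriv ?_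
    rw [smul_smul, neg_mul, inv_mul_cancel₀ (Nat.cast_add_one_ne_zero n), neg_smul, one_smul,
      neg_neg]

theorem norm_taylor_le {t : ℝ} (ht : t ∈ I) (n : ℕ) (k : Fin d → ℤ) :
    ‖taylor (a t) n k‖ ≤ M * R ^ n := by
  have := h.nonneg
  have := h.rate_pos
  refine (h.bound t ht n k).trans (mul_le_of_le_one_right (by positivity)
    (Real.exp_le_one_iff.2 ?_))
  have := len_nonneg k
  have := h.decay_pos
  rw [neg_nonpos]
  positivity

/-- The Taylor series at different centers have the same sum. -/
theorem tsum_taylor_eq {w : ℂ} {s t : ℝ} (hs : s ∈ I) (ht : t ∈ I)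
    (hws : ‖w - s‖ < 1 / (2 * R)) (hwt : ‖w - t‖ < 1 / (2 * R)) (k : Fin d → ℤ) :
    ∑' n : ℕ, (w - s) ^ n • taylor (a s) n k = ∑' n : ℕ, (w - t) ^ n • taylor (a t) n k := by
  have hM := h.nonneg
  have hR := h.rate_pos
  -- Centres in `I` close enough to `w` for ratio at most `1/2`; an intersection of convex sets,
  -- hence connected.
  set J : Set ℝ := I ∩ Complex.ofRealCLM ⁻¹' Metric.ball w (1 / (2 * R)) with hJ
  have hJo : IsOpen J :=
    h.isOpen.inter (Metric.isOpen_ball.preimage Complex.ofRealCLM.continuous)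
  have hJc : Convex ℝ J :=
    h.convex.inter ((convex_ball w _).linear_preimage Complex.ofRealCLM.toLinearMap)
  have hmem : ∀ x : ℝ, x ∈ J ↔ x ∈ I ∧ ‖w - x‖ < 1 / (2 * R) := fun x => by
    rw [hJ, mem_inter_iff, mem_preimage, Metric.mem_ball, dist_eq_norm, norm_sub_rev]
    rfl
  have hpow : ∀ x ∈ J, ∀ n : ℕ, ‖w - x‖ ^ n ≤ (1 / (2 * R)) ^ n := fun x hx n =>
    pow_le_pow_left₀ (norm_nonneg _) ((hmem x).1 hx).2.le n
  have hgeo : ∀ n : ℕ, (1 / (2 * R)) ^ n * R ^ n = (1 / 2) ^ n := fun n => by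
    rw [← mul_pow]
    congr 1
    field_simp
  -- The derivative of the `n`-th term in the centre is `b n - c n`. Since `c 0 = 0` and `c (n + 1)
  -- = b n`, the sum telescopes to zero.
  set b : ℕ → ℝ → Amp d := fun n x =>
    (w - x) ^ n • (((n : ℂ) + 1) • taylor (a x) (n + 1) k) with hb
  set c : ℕ → ℝ → Amp d := fun n x =>
    ((n : ℂ) * (w - x) ^ (n - 1)) • taylor (a x) n k with hc
  have hc0 : ∀ x, c 0 x = 0 := fun x => by simp [hc]
  have hcs : ∀ n x, c (n + 1) x = b n x := fun n x => by
    simp only [hc, hb, Nat.add_sub_cancel, smul_smul]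
    push_cast
    rw [mul_comm]
  have hbb : ∀ n, ∀ x ∈ J, ‖b n x‖ ≤ M * R * (((n : ℝ) + 1) * (1 / 2) ^ n) := by
    intro n x hx
    have hn : ‖(n : ℂ) + 1‖ = (n : ℝ) + 1 := by exact_mod_cast Complex.norm_natCast (n + 1)
    rw [hb, norm_smul, norm_smul, norm_pow, hn, ← hgeo]
    calc ‖w - x‖ ^ n * (((n : ℝ) + 1) * ‖taylor (a x) (n + 1) k‖)
        ≤ (1 / (2 * R)) ^ n * (((n : ℝ) + 1) * (M * R ^ (n + 1))) := by
          gcongr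
          · exact ((hmem x).1 hx).2.le
          · exact h.norm_taylor_le ((hmem x).1 hx).1 _ _
      _ = _ := by ring
  have hu : Summable fun n : ℕ => M * R * (((n : ℝ) + 1) * (1 / 2) ^ n) := by
    refine Summable.mul_left _ ?_
    simp only [add_mul, one_mul]
    have hhalf : ‖(1 / 2 : ℝ)‖ < 1 := by norm_num
    have h1 := summable_pow_mul_geometric_of_norm_lt_one 1 hhalf
    simp only [pow_one] at h1
    exact h1.add summable_geometric_two
  set u' : ℕ → ℝ := fun n => Nat.casesOn n 0 fun m => M * R * (((m : ℝ) + 1) * (1 / 2) ^ m)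
    with hu'
  have hu's : Summable u' := (summable_nat_add_iff 1).1 hu
  have hcb : ∀ n, ∀ x ∈ J, ‖c n x‖ ≤ u' n := by
    intro n x hx
    cases n with
    | zero => rw [hc0, norm_zero]; exact le_refl (0 : ℝ)
    | succ n => rw [hcs]; exact hbb n x hx
  have hder : ∀ n : ℕ, ∀ x ∈ J,
      HasDerivAt (fun y : ℝ => (w - y) ^ n • taylor (a y) n k) (b n x - c n x) x := by
    intro n x hx
    have h1 : HasDerivAt (fun y : ℝ => w - (y : ℂ)) (-1) x :=
      (Complex.ofRealCLM.hasDerivAt (x := x)).const_sub w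
    have h2 := (h1.pow n).smul (h.hasDerivAt_taylor n x ((hmem x).1 hx).1 k)
    refine h2.congr_deriv ?_
    simp only [hb, hc, mul_neg, mul_one, neg_smul, sub_eq_add_neg, Pi.pow_apply]
  have hsJ : s ∈ J := (hmem s).2 ⟨hs, hws⟩
  have htJ : t ∈ J := (hmem t).2 ⟨ht, hwt⟩
  have hsum : Summable fun n : ℕ => (w - s) ^ n • taylor (a s) n k := by
    refine Summable.of_norm_bounded (summable_geometric_two.mul_left M) fun n => ?_
    rw [norm_smul, norm_pow, ← hgeo]
    calc ‖w - s‖ ^ n * ‖taylor (a s) n k‖ ≤ (1 / (2 * R)) ^ n * (M * R ^ n) := by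
          gcongr
          exact h.norm_taylor_le hs _ _
      _ = _ := by ring
  have hD : ∀ x ∈ J, HasDerivAt (fun y : ℝ => ∑' n : ℕ, (w - y) ^ n • taylor (a y) n k) 0 x := by
    intro x hx
    have h1 := hasDerivAt_tsum_of_isPreconnected (hu.add hu's) hJo hJc.isPreconnected hder
      (fun n y hy => (norm_sub_le _ _).trans (add_le_add (hbb n y hy) (hcb n y hy))) hsJ hsum hx
    refine h1.congr_deriv ?_
    have hbs : Summable fun n => b n x := Summable.of_norm_bounded hu fun n => hbb n x hx
    have hcs' : Summable fun n => c n x := Summable.of_norm_bounded hu's fun n => hcb n x hx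
    rw [Summable.tsum_sub hbs hcs', hcs'.tsum_eq_zero_add, hc0, zero_add]
    simp only [hcs, sub_self]
  exact hJo.is_const_of_deriv_eq_zero hJc.isPreconnected
    (fun x hx => (hD x hx).differentiableAt.differentiableWithinAt) (fun x hx => (hD x hx).deriv)
    hsJ htJ

end AnalyticFlow

end TimeDerivative

/-! ### Extension to a complex strip and the equation there. -/

section Extension

variable {d : ℕ}

/-- The space of absolutely summable families of amplitudes. -/
abbrev WienerSpace (d : ℕ) : Type := lp (fun _ : Fin d → ℤ => Amp d) 1

/-- The Taylor coefficients of the flow, multiplied by exponential weights. -/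
def weightedTaylor (c : ℝ) (a : (Fin d → ℤ) → Amp d) (n : ℕ) : WienerSpace d :=
  open Classical in
  if h : Memℓp (fun k => ((Real.exp (c * len k) : ℝ) : ℂ) • taylor a n k) 1 then
    ⟨fun k => ((Real.exp (c * len k) : ℝ) : ℂ) • taylor a n k, h⟩ else 0

/-- The extension of a flow to complex times, defined by the Taylor series centred at the real part
of the time. -/
def complexFlow (c : ℝ) (a : ℝ → (Fin d → ℤ) → Amp d) (ζ : ℂ) : WienerSpace d :=
  ∑' n, (ζ - ζ.re) ^ n • weightedTaylor c (a ζ.re) n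

/-- The Fourier coefficients of the flow at complex times. -/
def complexMode (c : ℝ) (a : ℝ → (Fin d → ℤ) → Amp d) (ζ : ℂ) (k : Fin d → ℤ) : Amp d :=
  ((Real.exp (-(c * len k)) : ℝ) : ℂ) • complexFlow c a ζ k

/-- A strip of complex times around an interval of real times. -/
def strip (I : Set ℝ) (ρ : ℝ) : Set ℂ :=
  Complex.reCLM ⁻¹' I ∩ Complex.imCLM ⁻¹' Metric.ball 0 ρ

theorem mem_strip {I : Set ℝ} {ρ : ℝ} {ζ : ℂ} : ζ ∈ strip I ρ ↔ ζ.re ∈ I ∧ |ζ.im| < ρ := by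
  simp [strip]

theorem isOpen_strip {I : Set ℝ} (hI : IsOpen I) (ρ : ℝ) : IsOpen (strip I ρ) :=
  (hI.preimage Complex.reCLM.continuous).inter
    (Metric.isOpen_ball.preimage Complex.imCLM.continuous)

theorem isPreconnected_strip {I : Set ℝ} (hI : Convex ℝ I) (ρ : ℝ) :
    IsPreconnected (strip I ρ) :=
  ((hI.linear_preimage Complex.reCLM.toLinearMap).inter
    ((convex_ball (0 : ℝ) ρ).linear_preimage Complex.imCLM.toLinearMap)).isPreconnected

theorem norm_sub_re (ζ : ℂ) : ‖ζ - ζ.re‖ = |ζ.im| := by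
  have : ζ - ζ.re = ζ.im * Complex.I := by
    linear_combination -(Complex.re_add_im ζ)
  rw [this, norm_mul, Complex.norm_I, mul_one, Complex.norm_real, Real.norm_eq_abs]

theorem ofReal_mem_strip {I : Set ℝ} {ρ : ℝ} (hρ : 0 < ρ) {t : ℝ} (ht : t ∈ I) :
    (t : ℂ) ∈ strip I ρ := mem_strip.2 ⟨by simpa using ht, by simpa using hρ⟩

namespace AnalyticFlow

variable {I : Set ℝ} {γ M R : ℝ} {a : ℝ → (Fin d → ℤ) → Amp d} (h : AnalyticFlow I γ M R a)

include h

theorem norm_weight_smul_taylor_le {t : ℝ} (ht : t ∈ I) (n : ℕ) (k : Fin d → ℤ) :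
    ‖((Real.exp (γ / 2 * len k) : ℝ) : ℂ) • taylor (a t) n k‖
      ≤ M * R ^ n * Real.exp (-(γ / 2 * len k)) := by
  rw [norm_smul, Complex.norm_real, Real.norm_of_nonneg (Real.exp_pos _).le]
  refine (mul_le_mul_of_nonneg_left (h.bound t ht n k) (Real.exp_pos _).le).trans_eq ?_
  rw [mul_left_comm, ← Real.exp_add]
  ring_nf

theorem summable_weight : Summable fun k : Fin d → ℤ => Real.exp (-(γ / 2 * len k)) :=
  summable_exp_neg_mul_len (half_pos h.decay_pos)

/-- Decay at rate `γ` beats the weight `γ / 2`, so the default branch of the definition is not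
taken. -/
theorem weightedTaylor_apply {t : ℝ} (ht : t ∈ I) (n : ℕ) (k : Fin d → ℤ) :
    weightedTaylor (γ / 2) (a t) n k = ((Real.exp (γ / 2 * len k) : ℝ) : ℂ) • taylor (a t) n k := by
  have hm : Memℓp (fun k => ((Real.exp (γ / 2 * len k) : ℝ) : ℂ) • taylor (a t) n k) 1 := by
    refine memℓp_gen ?_
    simp only [ENNReal.toReal_one, Real.rpow_one]
    exact Summable.of_nonneg_of_le (fun _ => norm_nonneg _)
      (h.norm_weight_smul_taylor_le ht n) (h.summable_weight.mul_left _)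
  rw [weightedTaylor, dif_pos hm]

theorem norm_weightedTaylor_le {t : ℝ} (ht : t ∈ I) (n : ℕ) :
    ‖weightedTaylor (γ / 2) (a t) n‖
      ≤ M * (∑' k : Fin d → ℤ, Real.exp (-(γ / 2 * len k))) * R ^ n := by
  rw [lp.norm_eq_tsum_rpow (by simp)]
  simp only [ENNReal.toReal_one, Real.rpow_one, div_one, h.weightedTaylor_apply ht]
  rw [mul_right_comm, ← tsum_mul_left]
  exact Summable.tsum_le_tsum (h.norm_weight_smul_taylor_le ht n)
    (Summable.of_nonneg_of_le (fun _ => norm_nonneg _)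
      (h.norm_weight_smul_taylor_le ht n) (h.summable_weight.mul_left _))
    (h.summable_weight.mul_left _)

theorem norm_term_le {t : ℝ} (ht : t ∈ I) {w : ℂ} (hw : ‖w - t‖ < 1 / (2 * R)) (n : ℕ) :
    ‖(w - t) ^ n • weightedTaylor (γ / 2) (a t) n‖
      ≤ M * (∑' k : Fin d → ℤ, Real.exp (-(γ / 2 * len k))) * (1 / 2) ^ n := by
  have hR := h.rate_pos
  have hM := h.nonneg
  have hS : 0 ≤ ∑' k : Fin d → ℤ, Real.exp (-(γ / 2 * len k)) :=
    tsum_nonneg fun _ => (Real.exp_pos _).le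
  have hgeo : (1 / (2 * R)) ^ n * R ^ n = (1 / 2) ^ n := by
    rw [← mul_pow]
    congr 1
    field_simp
  rw [norm_smul, norm_pow]
  calc ‖w - t‖ ^ n * ‖weightedTaylor (γ / 2) (a t) n‖
      ≤ (1 / (2 * R)) ^ n * (M * (∑' k : Fin d → ℤ, Real.exp (-(γ / 2 * len k))) * R ^ n) := by
        gcongr
        exact h.norm_weightedTaylor_le ht n
    _ = _ := by rw [mul_left_comm, hgeo]

theorem summable_term {t : ℝ} (ht : t ∈ I) {w : ℂ} (hw : ‖w - t‖ < 1 / (2 * R)) :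
    Summable fun n => (w - t) ^ n • weightedTaylor (γ / 2) (a t) n :=
  Summable.of_norm_bounded (summable_geometric_two.mul_left _) (h.norm_term_le ht hw)

theorem norm_tsum_term_le {t : ℝ} (ht : t ∈ I) {w : ℂ} (hw : ‖w - t‖ < 1 / (2 * R)) :
    ‖∑' n, (w - t) ^ n • weightedTaylor (γ / 2) (a t) n‖
      ≤ M * (∑' k : Fin d → ℤ, Real.exp (-(γ / 2 * len k))) * 2 :=
  tsum_of_norm_bounded (hasSum_geometric_two.mul_left _) (h.norm_term_le ht hw)

theorem tsum_term_apply {t : ℝ} (ht : t ∈ I) {w : ℂ} (hw : ‖w - t‖ < 1 / (2 * R))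
    (k : Fin d → ℤ) :
    (∑' n, (w - t) ^ n • weightedTaylor (γ / 2) (a t) n : WienerSpace d) k
      = ((Real.exp (γ / 2 * len k) : ℝ) : ℂ) • ∑' n : ℕ, (w - t) ^ n • taylor (a t) n k := by
  have h1 := (lp.evalCLM ℂ (fun _ : Fin d → ℤ => Amp d) 1 k).map_tsum (h.summable_term ht hw)
  refine h1.trans ?_
  rw [← tsum_const_smul'']
  refine tsum_congr fun n => ?_
  change (w - t) ^ n • weightedTaylor (γ / 2) (a t) n k = _
  rw [h.weightedTaylor_apply ht, smul_comm]

/-- The centre in `complexFlow` moves with `ζ`, which hides holomorphy; a nearby fixed centre gives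
an honest power series. -/
theorem complexFlow_eq {t : ℝ} (ht : t ∈ I) {ζ : ℂ} (hζ : ζ ∈ strip I (1 / (2 * R)))
    (hζt : ‖ζ - t‖ < 1 / (2 * R)) :
    complexFlow (γ / 2) a ζ = ∑' n, (ζ - t) ^ n • weightedTaylor (γ / 2) (a t) n := by
  rw [mem_strip, ← norm_sub_re] at hζ
  refine lp.ext (funext fun k => ?_)
  rw [complexFlow, h.tsum_term_apply hζ.1 hζ.2, h.tsum_term_apply ht hζt,
    h.tsum_taylor_eq hζ.1 ht hζ.2 hζt]

theorem differentiableOn_complexFlow :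
    DifferentiableOn ℂ (complexFlow (γ / 2) a) (strip I (1 / (2 * R))) := by
  intro ζ hζ
  have hζ' := hζ
  rw [mem_strip, ← norm_sub_re] at hζ'
  have hd : DifferentiableOn ℂ
      (fun w : ℂ => ∑' n, (w - ζ.re) ^ n • weightedTaylor (γ / 2) (a ζ.re) n)
      (Metric.ball (ζ.re : ℂ) (1 / (2 * R))) := by
    refine Complex.differentiableOn_tsum_of_summable_norm (summable_geometric_two.mul_left _)
      (fun n => ?_) Metric.isOpen_ball fun n w hw => h.norm_term_le hζ'.1 (by
        rwa [Metric.mem_ball, dist_eq_norm] at hw) n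
    exact (((differentiable_id.sub_const _).pow n).smul_const _).differentiableOn
  have hb : Metric.ball (ζ.re : ℂ) (1 / (2 * R)) ∈ 𝓝 ζ :=
    Metric.isOpen_ball.mem_nhds (by rw [Metric.mem_ball, dist_eq_norm]; exact hζ'.2)
  refine DifferentiableAt.differentiableWithinAt ((hd.differentiableAt hb).congr_of_eventuallyEq ?_)
  filter_upwards [hb, (isOpen_strip h.isOpen _).mem_nhds hζ] with w hw hws
  rw [Metric.mem_ball, dist_eq_norm] at hw
  exact h.complexFlow_eq hζ'.1 hws hw

theorem complexMode_eq {ζ : ℂ} (hζ : ζ ∈ strip I (1 / (2 * R))) (k : Fin d → ℤ) :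
    complexMode (γ / 2) a ζ k = ∑' n : ℕ, (ζ - ζ.re) ^ n • taylor (a ζ.re) n k := by
  rw [mem_strip, ← norm_sub_re] at hζ
  rw [complexMode, complexFlow, h.tsum_term_apply hζ.1 hζ.2, smul_smul, ← Complex.ofReal_mul,
    ← Real.exp_add, neg_add_cancel, Real.exp_zero, Complex.ofReal_one, one_smul]

theorem complexMode_ofReal {t : ℝ} (ht : t ∈ I) (k : Fin d → ℤ) :
    complexMode (γ / 2) a t k = a t k := by
  have hR := h.rate_pos
  rw [h.complexMode_eq (ofReal_mem_strip (by positivity) ht), tsum_eq_single 0]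
  · simp [taylor_zero]
  · intro n hn
    simp [hn]

theorem modeProj_complexMode {ζ : ℂ} (hζ : ζ ∈ strip I (1 / (2 * R))) (k : Fin d → ℤ) :
    modeProj k (complexMode (γ / 2) a ζ k) = complexMode (γ / 2) a ζ k := by
  have hR := h.rate_pos
  have hM := h.nonneg
  rw [h.complexMode_eq hζ]
  rw [mem_strip, ← norm_sub_re] at hζ
  have hs : Summable fun n : ℕ => (ζ - ζ.re) ^ n • taylor (a ζ.re) n k := by
    have h1 := (lp.evalCLM ℂ (fun _ : Fin d → ℤ => Amp d) 1 k).summable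
      (h.summable_term hζ.1 hζ.2)
    refine (h1.const_smul ((Real.exp (-(γ / 2 * len k)) : ℝ) : ℂ)).congr fun n => ?_
    change ((Real.exp (-(γ / 2 * len k)) : ℝ) : ℂ) •
      (ζ - ζ.re) ^ n • weightedTaylor (γ / 2) (a ζ.re) n k = _
    rw [h.weightedTaylor_apply hζ.1, smul_comm, smul_smul ((Real.exp _ : ℝ) : ℂ),
      ← Complex.ofReal_mul, ← Real.exp_add, neg_add_cancel, Real.exp_zero, Complex.ofReal_one,
      one_smul]
  rw [(modeProj k).map_tsum hs]
  refine tsum_congr fun n => ?_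
  rw [map_smul, modeProj_taylor (h.proj _ hζ.1) fun p q k =>
    summable_modeBilin_of_decay h.decay_pos (by positivity) (by positivity)
      (h.bound _ hζ.1 p) (h.bound _ hζ.1 q) k]

theorem norm_complexMode_le {ζ : ℂ} (hζ : ζ ∈ strip I (1 / (2 * R))) (k : Fin d → ℤ) :
    ‖complexMode (γ / 2) a ζ k‖ ≤
      M * (∑' k : Fin d → ℤ, Real.exp (-(γ / 2 * len k))) * 2 * Real.exp (-(γ / 2 * len k)) := by
  rw [mem_strip, ← norm_sub_re] at hζ
  rw [complexMode, norm_smul, Complex.norm_real, Real.norm_of_nonneg (Real.exp_pos _).le, mul_comm]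
  gcongr
  exact (lp.norm_apply_le_norm one_ne_zero _ k).trans (h.norm_tsum_term_le hζ.1 hζ.2)

theorem differentiableOn_complexMode (k : Fin d → ℤ) :
    DifferentiableOn ℂ (fun ζ => complexMode (γ / 2) a ζ k) (strip I (1 / (2 * R))) :=
  ((lp.evalCLM ℂ (fun _ : Fin d → ℤ => Amp d) 1 k).differentiable.comp_differentiableOn
    h.differentiableOn_complexFlow).const_smul ((Real.exp (-(γ / 2 * len k)) : ℝ) : ℂ)

theorem differentiableOn_conv_complexMode (k : Fin d → ℤ) :
    DifferentiableOn ℂ (fun ζ => conv (complexMode (γ / 2) a ζ) (complexMode (γ / 2) a ζ) k)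
      (strip I (1 / (2 * R))) := by
  have hM := h.nonneg
  have hS : 0 ≤ ∑' k : Fin d → ℤ, Real.exp (-(γ / 2 * len k)) :=
    tsum_nonneg fun _ => (Real.exp_pos _).le
  refine Complex.differentiableOn_tsum_of_summable_norm (h.summable_weight.mul_left _) (fun j => ?_)
    (isOpen_strip h.isOpen _) fun j w hw =>
      norm_modeBilin_le_of_decay (half_pos h.decay_pos) (by positivity) (by positivity)
        (h.norm_complexMode_le hw) (h.norm_complexMode_le hw) k j
  exact ((modeBilin k).differentiable.comp_differentiableOn
    (h.differentiableOn_complexMode j)).clm_apply (h.differentiableOn_complexMode (k - j))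

/-- The Euler equation at complex times. -/
theorem deriv_complexMode_add_conv {ζ : ℂ} (hζ : ζ ∈ strip I (1 / (2 * R))) (k : Fin d → ℤ) :
    deriv (fun z => complexMode (γ / 2) a z k) ζ
      + conv (complexMode (γ / 2) a ζ) (complexMode (γ / 2) a ζ) k = 0 := by
  have hR := h.rate_pos
  have hρ : 0 < 1 / (2 * R) := by positivity
  have ho := isOpen_strip h.isOpen (1 / (2 * R))
  have hA : AnalyticOnNhd ℂ (fun w => deriv (fun z => complexMode (γ / 2) a z k) w
      + conv (complexMode (γ / 2) a w) (complexMode (γ / 2) a w) k) (strip I (1 / (2 * R))) :=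
    (((h.differentiableOn_complexMode k).deriv ho).add
      (h.differentiableOn_conv_complexMode k)).analyticOnNhd ho
  have hreal : ∀ t ∈ I, deriv (fun z => complexMode (γ / 2) a z k) (t : ℂ)
      + conv (complexMode (γ / 2) a t) (complexMode (γ / 2) a t) k = 0 := by
    intro t ht
    have h1 := ((h.differentiableOn_complexMode k).differentiableAt
      (ho.mem_nhds (ofReal_mem_strip hρ ht))).hasDerivAt.scomp t
        (Complex.ofRealCLM.hasDerivAt (x := t))
    rw [Complex.ofRealCLM_apply, Complex.ofReal_one, one_smul] at h1
    have h2 : HasDerivAt (fun s : ℝ => complexMode (γ / 2) a s k) (-conv (a t) (a t) k) t := by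
      refine (h.hasDeriv t ht k).congr_of_eventuallyEq ?_
      filter_upwards [h.isOpen.mem_nhds ht] with s hs
      exact h.complexMode_ofReal hs k
    have h3 : complexMode (γ / 2) a (t : ℂ) = a t := funext fun k => h.complexMode_ofReal ht k
    rw [h1.unique h2, h3, neg_add_cancel]
  have hζI : ζ.re ∈ I := (mem_strip.1 hζ).1
  -- Identity theorem: the residual is analytic on the connected strip and vanishes at the real
  -- times accumulating at `ζ.re`.
  refine hA.eqOn_zero_of_preconnected_of_frequently_eq_zero
    (isPreconnected_strip h.convex _) (ofReal_mem_strip hρ hζI) ?_ hζ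
  have ht : Tendsto (fun s : ℝ => (s : ℂ)) (𝓝[≠] ζ.re) (𝓝[≠] (ζ.re : ℂ)) :=
    tendsto_nhdsWithin_of_tendsto_nhds_of_eventually_within _
      (Complex.continuous_ofReal.continuousWithinAt.tendsto) (by
        filter_upwards [self_mem_nhdsWithin] with s hs
        simpa using hs)
  refine ht.frequently (Eventually.frequently ?_)
  filter_upwards [mem_nhdsWithin_of_mem_nhds (h.isOpen.mem_nhds hζI)] with s hs
  exact hreal s hs

end AnalyticFlow

end Extension

/-! ### From weighted amplitudes to fields, and between Gevrey bounds and decay. -/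

section Synthesis

variable {d : ℕ}

/-- The Fourier amplitude at `k` of the field synthesised from a summable family. -/
def synthAmp (c : ℝ) (k : Fin d → ℤ) : WienerSpace d →L[ℂ] Amp d :=
  (modeProj k).comp (((Real.exp (-(c * len k)) : ℝ) : ℂ) •
    lp.evalCLM ℂ (fun _ : Fin d → ℤ => Amp d) 1 k)

theorem synthAmp_apply (c : ℝ) (k : Fin d → ℤ) (A : WienerSpace d) :
    synthAmp c k A = modeProj k (((Real.exp (-(c * len k)) : ℝ) : ℂ) • A k) := rfl

theorem norm_synthAmp_le (c : ℝ) (k : Fin d → ℤ) (A : WienerSpace d) :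
    ‖synthAmp c k A‖ ≤ 2 * Real.exp (-(c * len k)) * ‖A k‖ := by
  rw [synthAmp_apply]
  refine (norm_modeProj_le k _).trans_eq ?_
  rw [norm_smul, Complex.norm_real, Real.norm_of_nonneg (Real.exp_pos _).le, mul_assoc]

theorem norm_synthAmp_le' {c : ℝ} (hc : 0 < c) (k : Fin d → ℤ) (A : WienerSpace d) :
    ‖synthAmp c k A‖ ≤ 2 * ‖A k‖ := by
  refine (norm_synthAmp_le c k A).trans ?_
  gcongr
  refine mul_le_of_le_one_right zero_le_two (Real.exp_le_one_iff.2 ?_)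
  have := len_nonneg k
  rw [neg_nonpos]
  positivity

theorem hasSum_norm_wiener (A : WienerSpace d) : HasSum (fun k => ‖A k‖) ‖A‖ := by
  simpa using lp.hasSum_norm (by simp) A

theorem summable_norm_synthAmp {c : ℝ} (hc : 0 < c) (A : WienerSpace d) :
    Summable fun k => ‖synthAmp c k A‖ :=
  Summable.of_nonneg_of_le (fun _ => norm_nonneg _) (fun k => norm_synthAmp_le' hc k A)
    ((hasSum_norm_wiener A).summable.mul_left 2)

theorem memLp_fourierSeries {a : (Fin d → ℤ) → Amp d} (ha : Summable fun k => ‖a k‖) :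
    MemLp (fourierSeries a) 2 (volume.restrict (cell d)) :=
  MemLp.of_bound (continuous_fourierSeries ha).aestronglyMeasurable _
    (Eventually.of_forall (norm_fourierSeries_le ha))

theorem coeff_toLp_fourierSeries {a : (Fin d → ℤ) → Amp d} (ha : Summable fun k => ‖a k‖)
    (k : Fin d → ℤ) : coeff ((memLp_fourierSeries ha).toLp : L2Field d) k = a k := by
  rw [coeff_congr_ae (memLp_fourierSeries ha).coeFn_toLp, coeff_fourierSeries ha]

/-- The solenoidal field with prescribed Fourier amplitudes. -/
def synthField {c : ℝ} (hc : 0 < c) (A : WienerSpace d) : PhaseSpace d :=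
  ⟨(memLp_fourierSeries (summable_norm_synthAmp hc A)).toLp, by
    constructor
    · rw [coeff_toLp_fourierSeries (summable_norm_synthAmp hc A), synthAmp_apply, modeProj, if_pos rfl]
      rfl
    · intro k
      rw [coeff_toLp_fourierSeries (summable_norm_synthAmp hc A), ← inner_waveVec, synthAmp_apply, inner_modeProj]⟩

theorem hat_synthField {c : ℝ} (hc : 0 < c) (A : WienerSpace d) (k : Fin d → ℤ) :
    hat (synthField hc A) k = synthAmp c k A :=
  coeff_toLp_fourierSeries (summable_norm_synthAmp hc A) k

theorem hat_add (u v : PhaseSpace d) (k : Fin d → ℤ) : hat (u + v) k = hat u k + hat v k :=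
  coeff_add _ _ k

theorem hat_smul (c : ℂ) (u : PhaseSpace d) (k : Fin d → ℤ) : hat (c • u) k = c • hat u k :=
  coeff_smul _ _ k

theorem norm_synthField_le {c : ℝ} (hc : 0 < c) (A : WienerSpace d) :
    ‖synthField hc A‖ ≤
      (measureUnivNNReal ((volume : Measure (Fin d → ℝ)).restrict (cell d)) : ℝ) ^
        (ENNReal.toReal 2)⁻¹ * 2 * ‖A‖ := by
  have h1 : ∑' k, ‖synthAmp c k A‖ ≤ 2 * ‖A‖ := by
    rw [← (hasSum_norm_wiener A).tsum_eq, ← tsum_mul_left]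
    exact (summable_norm_synthAmp hc A).tsum_le_tsum (fun k => norm_synthAmp_le' hc k A)
      ((hasSum_norm_wiener A).summable.mul_left 2)
  rw [mul_assoc]
  refine Lp.norm_le_of_ae_bound (f := (synthField hc A : L2Field d)) (by positivity) ?_
  filter_upwards [(memLp_fourierSeries (summable_norm_synthAmp hc A)).coeFn_toLp] with x hx
  refine le_trans (le_of_eq (congrArg norm hx)) ?_
  exact (norm_fourierSeries_le (summable_norm_synthAmp hc A) x).trans h1

/-- Synthesis of solenoidal fields as a continuous linear map. -/
def synth {c : ℝ} (hc : 0 < c) : WienerSpace d →L[ℂ] PhaseSpace d :=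
  LinearMap.mkContinuous
    { toFun := synthField hc
      map_add' := fun A B => hat_injective fun k => by
        simp only [hat_add, hat_synthField, map_add]
      map_smul' := fun z A => hat_injective fun k => by
        simp only [hat_smul, hat_synthField, map_smul, RingHom.id_apply] }
    _ (norm_synthField_le hc)

theorem hat_synth {c : ℝ} (hc : 0 < c) (A : WienerSpace d) (k : Fin d → ℤ) :
    hat (synth hc A) k = synthAmp c k A := hat_synthField hc A k

/-- For `len k ≥ 1` the exponent rises to an integer `n`, and `x ^ n / n! ≤ exp x` applies; at `k =
0` the left side is 0. -/
theorem len_rpow_le {r : ℝ} (hr : 0 < r) {c : ℝ} (hc : 0 < c) :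
    ∃ B : ℝ, 0 ≤ B ∧ ∀ k : Fin d → ℤ, len k ^ r ≤ B * Real.exp (c * len k) := by
  obtain ⟨n, hn⟩ := exists_nat_ge r
  refine ⟨n.factorial * c⁻¹ ^ n, by positivity, fun k => ?_⟩
  rcases eq_or_ne k 0 with rfl | hk
  · rw [len_zero, Real.zero_rpow hr.ne']
    positivity
  · have h1 : len k ^ r ≤ len k ^ n := by
      rw [← Real.rpow_natCast]
      exact Real.rpow_le_rpow_of_exponent_le (one_le_len hk) hn
    have hx : 0 ≤ c * len k := mul_nonneg hc.le (len_nonneg k)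
    have h2 := Real.pow_div_factorial_le_exp (c * len k) hx n
    rw [div_le_iff₀ (by positivity), mul_pow] at h2
    calc len k ^ r ≤ len k ^ n := h1
      _ = c⁻¹ ^ n * (c ^ n * len k ^ n) := by
        rw [← mul_assoc, ← mul_pow, inv_mul_cancel₀ hc.ne', one_pow, one_mul]
      _ ≤ c⁻¹ ^ n * (Real.exp (c * len k) * n.factorial) := by gcongr
      _ = _ := by ring

/-- Of the factor `exp (-(c * len k))` in `synthAmp`, one half pays for the Gevrey weight `c / 2`
and the other for `len k ^ r`. -/
theorem gevreyNorm_synth_le {r : ℝ} (hr : 0 < r) {c : ℝ} (hc : 0 < c) :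
    ∃ K : ℝ, 0 ≤ K ∧ ∀ A : WienerSpace d,
      gevreyNorm r (c / 2) (synth hc A) ≤ ENNReal.ofReal (K * ‖A‖) := by
  obtain ⟨B, hB, hlen⟩ := len_rpow_le (d := d) hr (half_pos hc)
  refine ⟨Real.sqrt ((2 * Real.pi) ^ d) * (2 * B), by positivity, fun A => ?_⟩
  have hterm : ∀ k, len k ^ r * Real.exp (c / 2 * len k) * ‖hat (synth hc A) k‖
      ≤ 2 * B * ‖A k‖ := by
    intro k
    rw [hat_synth]
    calc len k ^ r * Real.exp (c / 2 * len k) * ‖synthAmp c k A‖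
        ≤ (B * Real.exp (c / 2 * len k)) * Real.exp (c / 2 * len k) *
          (2 * Real.exp (-(c * len k)) * ‖A k‖) := by
          gcongr
          · exact hlen k
          · exact norm_synthAmp_le c k A
      _ = 2 * B * ‖A k‖ * (Real.exp (c / 2 * len k) * Real.exp (c / 2 * len k) *
          Real.exp (-(c * len k))) := by ring
      _ = 2 * B * ‖A k‖ := by
          rw [← Real.exp_add, ← Real.exp_add]
          ring_nf
          rw [Real.exp_zero]
          ring
  -- Passage from `ℓ¹` to `ℓ²`: one factor `‖A k‖` of the square is bounded by `‖A‖`.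
  have hsq : ∀ k, (len k ^ r * Real.exp (c / 2 * len k) * ‖hat (synth hc A) k‖) ^ 2
      ≤ (2 * B) ^ 2 * ‖A‖ * ‖A k‖ := by
    intro k
    have h0 : 0 ≤ len k ^ r * Real.exp (c / 2 * len k) * ‖hat (synth hc A) k‖ := by
      have := Real.rpow_nonneg (len_nonneg k) r
      positivity
    refine (pow_le_pow_left₀ h0 (hterm k) 2).trans ?_
    have h1 := lp.norm_apply_le_norm one_ne_zero A k
    calc (2 * B * ‖A k‖) ^ 2 = (2 * B) ^ 2 * ‖A k‖ * ‖A k‖ := by ring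
      _ ≤ _ := by gcongr
  have hsum : ∑' k, ENNReal.ofReal
      ((len k ^ r * Real.exp (c / 2 * len k) * ‖hat (synth hc A) k‖) ^ 2)
      ≤ ENNReal.ofReal ((2 * B * ‖A‖) ^ 2) := by
    have hS := (hasSum_norm_wiener A).mul_left ((2 * B) ^ 2 * ‖A‖)
    calc _ ≤ ∑' k, ENNReal.ofReal ((2 * B) ^ 2 * ‖A‖ * ‖A k‖) :=
          ENNReal.tsum_le_tsum fun k => ENNReal.ofReal_le_ofReal (hsq k)
      _ = ENNReal.ofReal ((2 * B) ^ 2 * ‖A‖ * ‖A‖) := by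
          rw [← ENNReal.ofReal_tsum_of_nonneg (fun k => by positivity) hS.summable, hS.tsum_eq]
      _ = _ := by ring_nf
  have hpi : 0 ≤ (2 * Real.pi) ^ d := by positivity
  calc gevreyNorm r (c / 2) (synth hc A)
      ≤ (ENNReal.ofReal ((2 * Real.pi) ^ d) * ENNReal.ofReal ((2 * B * ‖A‖) ^ 2)) ^
          (1 / 2 : ℝ) := by
        unfold gevreyNorm
        gcongr
    _ = ENNReal.ofReal (Real.sqrt ((2 * Real.pi) ^ d * (2 * B * ‖A‖) ^ 2)) := by
        rw [← ENNReal.ofReal_mul hpi, ENNReal.ofReal_rpow_of_nonneg (by positivity) (by norm_num),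
          Real.sqrt_eq_rpow]
    _ = _ := by
        rw [Real.sqrt_mul hpi, Real.sqrt_sq (by positivity), ← mul_assoc]

/-- A single term is bounded by the whole sum, and `len k ^ r` and `(2π)^d` are at least 1 for `k ≠
0`; the mode `k = 0` vanishes by zero mean. -/
theorem norm_hat_le_of_gevreyNorm_le {r β S : ℝ} (hr : 0 < r) (hS : 0 ≤ S) {u : PhaseSpace d}
    (hu : gevreyNorm r β u ≤ ENNReal.ofReal S) (k : Fin d → ℤ) :
    ‖hat u k‖ ≤ S * Real.exp (-(β * len k)) := by
  rcases eq_or_ne k 0 with rfl | hk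
  · rw [show hat u 0 = 0 from u.2.1, norm_zero]
    positivity
  set x := len k ^ r * Real.exp (β * len k) * ‖hat u k‖ with hx
  have hlen : 1 ≤ len k ^ r := Real.one_le_rpow (one_le_len hk) hr.le
  have hx0 : 0 ≤ x := by positivity
  have h1 : ENNReal.ofReal (x ^ 2) ≤ ENNReal.ofReal ((2 * Real.pi) ^ d) *
      ∑' k : Fin d → ℤ,
        ENNReal.ofReal ((len k ^ r * Real.exp (β * len k) * ‖hat u k‖) ^ 2) := by
    refine (ENNReal.le_tsum k).trans (le_mul_of_one_le_left zero_le ?_)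
    rw [ENNReal.one_le_ofReal]
    exact one_le_pow₀ (by linarith [Real.pi_gt_three])
  have h2 : ENNReal.ofReal x ≤ gevreyNorm r β u := by
    refine le_trans (le_of_eq ?_) (ENNReal.rpow_le_rpow h1 (by norm_num : (0 : ℝ) ≤ 1 / 2))
    rw [ENNReal.ofReal_rpow_of_nonneg (by positivity) (by norm_num), ← Real.sqrt_eq_rpow,
      Real.sqrt_sq hx0]
  have h3 : x ≤ S := (ENNReal.ofReal_le_ofReal_iff hS).1 (h2.trans hu)
  rw [Real.exp_neg, ← div_eq_mul_inv, le_div_iff₀ (by positivity)]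
  calc ‖hat u k‖ * Real.exp (β * len k) = 1 * Real.exp (β * len k) * ‖hat u k‖ := by ring
    _ ≤ x := by rw [hx]; gcongr
    _ ≤ S := h3

theorem wienerNorm_le_of_decay {δ β S : ℝ} (hδ : δ < β) {a : (Fin d → ℤ) → Amp d}
    (ha : ∀ k, ‖a k‖ ≤ S * Real.exp (-(β * len k))) :
    wienerNorm δ a ≤ ENNReal.ofReal (S * ∑' k : Fin d → ℤ, Real.exp (-((β - δ) * len k))) := by
  have hS : 0 ≤ S := nonneg_of_mul_nonneg_left ((norm_nonneg _).trans (ha 0)) (Real.exp_pos _)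
  rw [← tsum_mul_left, ENNReal.ofReal_tsum_of_nonneg (fun _ => by positivity)
    ((summable_exp_neg_mul_len (sub_pos.2 hδ)).mul_left S)]
  refine ENNReal.tsum_le_tsum fun k => ?_
  rw [← ofReal_norm, ← ENNReal.ofReal_mul (Real.exp_pos _).le]
  refine ENNReal.ofReal_le_ofReal
    ((mul_le_mul_of_nonneg_left (ha k) (Real.exp_pos _).le).trans_eq ?_)
  rw [mul_left_comm, ← Real.exp_add]
  ring_nf

theorem summable_norm_of_decay {γ C : ℝ} (hγ : 0 < γ) {a : (Fin d → ℤ) → Amp d}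
    (ha : ∀ k, ‖a k‖ ≤ C * Real.exp (-(γ * len k))) : Summable fun k => ‖a k‖ :=
  Summable.of_nonneg_of_le (fun _ => norm_nonneg _) ha ((summable_exp_neg_mul_len hγ).mul_left C)

/-- A solution of the Euler equation that is bounded in a Gevrey class has uniformly controlled
Taylor coefficients. -/
theorem IsEulerSolution.exists_analyticFlow {T : ℝ} {u : ℝ → PhaseSpace d}
    (hu : IsEulerSolution T u) {β S : ℝ} (hβ : 0 < β) (hS : 0 ≤ S)
    (hM : ∀ t ∈ Icc 0 T, ∀ k, ‖hat (u t) k‖ ≤ S * Real.exp (-(β * len k))) :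
    ∃ γ M R : ℝ, AnalyticFlow (Ioo 0 T) γ M R fun t => hat (u t) := by
  have hsum : 0 ≤ ∑' k : Fin d → ℤ, Real.exp (-((β - β / 2) * len k)) :=
    tsum_nonneg fun _ => (Real.exp_pos _).le
  -- The added 1 makes the rate `R` strictly positive.
  set M := S * ∑' k : Fin d → ℤ, Real.exp (-((β - β / 2) * len k)) + 1 with hMdef
  have hM0 : 0 < M := by positivity
  -- One halving of `β` buys summability in the Wiener norm, the other is the loss in
  -- `wienerNorm_taylor_le`.
  refine ⟨β / 2 / 2, M, 96 * M / (β / 2), isOpen_Ioo, convex_Ioo 0 T, by positivity, hM0.le,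
    by positivity, ?_, ?_, fun t _ k => modeProj_hat (u t) k⟩
  · intro t ht k
    have hs := summable_norm_of_decay hβ (hM t (Ioo_subset_Icc_self ht))
    have h1 := (hu.equation t (Ioo_subset_Icc_self ht) k).hasDerivAt (Icc_mem_nhds ht.1 ht.2)
    rwa [nonlin_eq_conv _ _ hs hs] at h1
  · intro t ht n k
    have h1 : wienerNorm (β / 2) (hat (u t)) ≤ ENNReal.ofReal M :=
      (wienerNorm_le_of_decay (half_lt_self hβ) (hM t (Ioo_subset_Icc_self ht))).trans
        (ENNReal.ofReal_le_ofReal (by rw [hMdef]; linarith))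
    exact norm_le_of_wienerNorm_le (by positivity)
      (wienerNorm_taylor_le (half_pos hβ) hM0.le h1 n) k

theorem exists_uniform_decay {T : ℝ} (hT : 0 < T) {r : ℝ} (hr : 0 < r) {u : ℝ → PhaseSpace d}
    {β : ℝ → ℝ} (hβ_cont : ContinuousOn β (Icc 0 T)) (hβ_pos : ∀ t ∈ Icc 0 T, 0 < β t)
    (hM : (⨆ t ∈ Icc 0 T, gevreyNorm r (β t) (u t)) < ∞) :
    ∃ β₀ S : ℝ, 0 < β₀ ∧ 0 ≤ S ∧
      ∀ t ∈ Icc 0 T, ∀ k, ‖hat (u t) k‖ ≤ S * Real.exp (-(β₀ * len k)) := by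
  obtain ⟨t₀, ht₀, hmin⟩ := isCompact_Icc.exists_isMinOn (nonempty_Icc.2 hT.le) hβ_cont
  refine ⟨β t₀, (⨆ t ∈ Icc 0 T, gevreyNorm r (β t) (u t)).toReal, hβ_pos t₀ ht₀,
    ENNReal.toReal_nonneg, fun t ht k => ?_⟩
  have h1 : gevreyNorm r (β t) (u t) ≤
      ENNReal.ofReal (⨆ t ∈ Icc 0 T, gevreyNorm r (β t) (u t)).toReal := by
    rw [ENNReal.ofReal_toReal hM.ne]
    exact le_iSup₂ (f := fun t (_ : t ∈ Icc 0 T) => gevreyNorm r (β t) (u t)) t ht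
  refine (norm_hat_le_of_gevreyNorm_le hr ENNReal.toReal_nonneg h1 k).trans ?_
  have h2 : β t₀ ≤ β t := hmin ht
  have := len_nonneg k
  gcongr

/-- Difference quotients commute with the linear map `synth`, so its bound into the Gevrey class
transfers convergence from the `ℓ¹` space. -/
theorem hasGevreyDerivAt_synth {r : ℝ} (hr : 0 < r) {c : ℝ} (hc : 0 < c)
    {G : ℂ → WienerSpace d} {G' : WienerSpace d} {ζ : ℂ} (hG : HasDerivAt G G' ζ) :
    HasGevreyDerivAt r (c / 2) (fun z => synth hc (G z)) (synth hc G') ζ := by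
  obtain ⟨K, hK, hle⟩ := gevreyNorm_synth_le (d := d) hr hc
  have hfin : ∀ A, gevreyNorm r (c / 2) (synth hc A) < ∞ := fun A =>
    (hle A).trans_lt ENNReal.ofReal_lt_top
  refine ⟨Eventually.of_forall fun z => hfin _, hfin _, ?_⟩
  have h1 : Tendsto (fun z => ENNReal.ofReal (K * ‖slope G ζ z - G'‖)) (𝓝[≠] ζ) (𝓝 0) := by
    have h2 := ((hasDerivAt_iff_tendsto_slope.1 hG).sub_const G').norm.const_mul K
    rw [sub_self, norm_zero, mul_zero] at h2
    simpa using ENNReal.tendsto_ofReal h2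
  refine tendsto_of_tendsto_of_tendsto_of_le_of_le tendsto_const_nhds h1 (fun _ => zero_le)
    fun z => ?_
  refine le_trans (le_of_eq ?_) (hle (slope G ζ z - G'))
  rw [map_sub, slope_def_module, map_smul, map_sub]

end Synthesis

end

end PeriodicEuler

/-! ### Assembly of the main theorem. -/

open PeriodicEuler in
theorem corollary3p2 (d : ℕ) (hd : d = 2 ∨ d = 3) (r : ℝ) (hr : ((d : ℝ) + 1) / 2 < r)
    (T : ℝ) (hT : 0 < T) (u : ℝ → PhaseSpace d) (hu : IsEulerSolution T u)
    (β : ℝ → ℝ) (hβ_cont : ContinuousOn β (Icc 0 T)) (hβ_pos : ∀ t ∈ Icc 0 T, 0 < β t)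
    (hM : (⨆ t ∈ Icc 0 T, gevreyNorm r (β t) (u t)) < ∞) :
    ∃ U : Set ℂ, IsOpen U ∧ (∀ t ∈ Ioo 0 T, (t : ℂ) ∈ U) ∧
      ∃ v : ℂ → PhaseSpace d,
        (∀ t ∈ Ioo 0 T, v (t : ℂ) = u t) ∧
        DifferentiableOn ℂ v U ∧
        (∃ β₁ : ℝ, 0 < β₁ ∧ ∀ ζ ∈ U, HasGevreyDerivAt r β₁ v (deriv v ζ) ζ) ∧
        ∀ ζ ∈ U, ∀ k : Fin d → ℤ, hat (deriv v ζ) k + nonlin (v ζ) (v ζ) k = 0 := by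
  have hr0 : 0 < r := lt_trans (by positivity) hr
  obtain ⟨β₀, S, hβ₀, hS, hdecay⟩ := exists_uniform_decay hT hr0 hβ_cont hβ_pos hM
  obtain ⟨γ, M, R, h⟩ := hu.exists_analyticFlow hβ₀ hS hdecay
  have hc : 0 < γ / 2 := half_pos h.decay_pos
  have hR := h.rate_pos
  have hρ : 0 < 1 / (2 * R) := by positivity
  have hU := isOpen_strip h.isOpen (1 / (2 * R))
  set a : ℝ → (Fin d → ℤ) → Amp d := fun t => hat (u t)
  set G := complexFlow (γ / 2) a with hG
  have hGd : ∀ ζ ∈ strip (Ioo 0 T) (1 / (2 * R)), HasDerivAt G (deriv G ζ) ζ := fun ζ hζ =>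
    (h.differentiableOn_complexFlow.differentiableAt (hU.mem_nhds hζ)).hasDerivAt
  have hvd : ∀ ζ ∈ strip (Ioo 0 T) (1 / (2 * R)),
      HasDerivAt (fun z => synth hc (G z)) (synth hc (deriv G ζ)) ζ := fun ζ hζ =>
    (synth hc).hasFDerivAt.comp_hasDerivAt ζ (hGd ζ hζ)
  -- The projection inside the synthesis fixes the modes of the flow, so the synthesised field has
  -- exactly these coefficients.
  have hhat : ∀ ζ ∈ strip (Ioo 0 T) (1 / (2 * R)), ∀ k,
      synthAmp (γ / 2) k (G ζ) = complexMode (γ / 2) a ζ k := fun ζ hζ k =>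
    h.modeProj_complexMode hζ k
  refine ⟨strip (Ioo 0 T) (1 / (2 * R)), hU, fun t ht => ofReal_mem_strip hρ ht,
    fun z => synth hc (G z), fun t ht => hat_injective fun k => ?_, fun ζ hζ =>
      (hvd ζ hζ).differentiableAt.differentiableWithinAt,
    ⟨γ / 2 / 2, half_pos hc, fun ζ hζ => ?_⟩, fun ζ hζ k => ?_⟩
  · rw [hat_synth, hhat _ (ofReal_mem_strip hρ ht), h.complexMode_ofReal ht]
  · rw [(hvd ζ hζ).deriv]
    exact hasGevreyDerivAt_synth hr0 hc (hGd ζ hζ)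
  · have hfun : hat (synth hc (G ζ)) = complexMode (γ / 2) a ζ := funext fun k => by
      rw [hat_synth, hhat ζ hζ]
    have hs : Summable fun k => ‖hat (synth hc (G ζ)) k‖ := by
      rw [hfun]
      exact summable_norm_of_decay hc (h.norm_complexMode_le hζ)
    -- Taking a mode is continuous and linear, so the mode of the derivative is the derivative of
    -- the mode.
    have h1 : HasDerivAt (fun z => complexMode (γ / 2) a z k)
        (synthAmp (γ / 2) k (deriv G ζ)) ζ := by
      refine ((synthAmp (γ / 2) k).hasFDerivAt.comp_hasDerivAt ζ (hGd ζ hζ)).congr_of_eventuallyEq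
        ?_
      filter_upwards [hU.mem_nhds hζ] with z hz
      exact (hhat z hz k).symm
    rw [(hvd ζ hζ).deriv, nonlin_eq_conv _ _ hs hs, hfun, hat_synth, ← h1.deriv]
    exact h.deriv_complexMode_add_conv hζ k
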